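/- **Setting.** Let $\phi=\mathbf 1_{[0,1]}$ and let $\psi,\tilde\phi,\tilde\psi:\mathbb R\to\mathbb R$ be compactly supported functions which generate, together with $\phi$, a biorthogonal wavelet basis of some order $r\ge 0$. This means: $\psi$ is piecewise constant (finitely many break points) and orthogonal to all polynomials of degree at most $r$; $\tilde\phi,\tilde\psi\in\mathbb L_2(\mathbb R)$ and, if $r>0$, $\tilde\phi$ and $\tilde\psi$ belong to the Hölder space $C^{r+1}$ (for $r=0$ no regularity is asked, so that the Haar basis is included). Put $\Lambda=\{(j,k)\in\mathbb Z^2: j\ge -1\}$ and, for $\lambda=(j,k)\in\Lambda$, $\varphi_\lambda(x)=\phi(x-k)$ if $j=-1$, $\varphi_\lambda(x)=2^{j/2}\psi(2^jx-k)$ if $j\ge 0$, and define $\tilde\varphi_\lambda$ in the same way from $\tilde\phi,\tilde\psi$. Then $\int\varphi_\lambda\tilde\varphi_{\lambda'}=\mathbf 1_{\lambda=\lambda'}$ for all $\lambda,\lambda'\in\Lambda$, and every $g\in\mathbb L_2(\mathbb R)$ satisfies $g=\sum_{\lambda\in\Lambda}\big(\int\varphi_\lambda g\big)\tilde\varphi_\lambda$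 (unconditional convergence in $\mathbb L_2$). Let $f\ge0$ with $f\in\mathbb L_1(\mathbb R)\cap\mathbb L_2(\mathbb R)$ (no assumption on the support of $f$, no boundedness assumption), and let $\beta_\lambda=\int\varphi_\lambda f$. For $n\ge 1$ let $N$ be a Poisson process on $\mathbb R$ with mean measure $n f(x)\,dx$; write $\int g\,dN=\sum_{T\in N}g(T)$. For $\gamma>0$ put $$\hat\beta_\lambda=\frac1n\int\varphi_\lambda\,dN,\qquad V_{\lambda,n}=\mathrm{Var}(\hat\beta_\lambda)=\frac1n\int\varphi_\lambda^2(x)f(x)\,dx,\qquad \hat V_{\lambda,n}=\frac1{n^2}\int\varphi_\lambda^2\,dN,$$ $$\tilde V_{\lambda,n}=\hat V_{\lambda,n}+\sqrt{2\gamma\log n\,\hat V_{\lambda,n}\frac{\|\varphi_\lambda\|_\infty^2}{n^2}}+3\gamma\log n\,\frac{\|\varphi_\lambda\|_\infty^2}{n^2},\qquad \eta_{\lambda,\gamma}=\sqrt{2\gamma\tilde V_{\lambda,n}\log n}+\frac{\gamma\log n}{3n}\|\varphi_\lambda\|_\infty .$$ For an integer $j_0=j_0(n)$ let $\Gamma_n=\{(j,k)\in\Lambda: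 j\le j_0\}$, $\tilde\beta_\lambda=\hat\beta_\lambda\mathbf 1_{\{|\hat\beta_\lambda|\ge\eta_{\lambda,\gamma}\}}\mathbf 1_{\{\lambda\in\Gamma_n\}}$ and $\tilde f_{n,\gamma}=\sum_{\lambda\in\Lambda}\tilde\beta_\lambda\tilde\varphi_\lambda$. **Theorem 1.** Fix $c\ge1$, $c'\in\mathbb R$ and $\gamma>c$, and for each $n\ge2$ let $j_0=j_0(n)$ be the integer such that $2^{j_0}\le n^c(\log n)^{c'}<2^{j_0+1}$. Then, for all $n$ large enough, $$\mathbb E\big(\|\tilde f_{n,\gamma}-f\|_2^2\big)\le C_1\Big[\sum_{\lambda\in\Gamma_n}\min(\beta_\lambda^2,V_{\lambda,n}\log n)+\sum_{\lambda\notin\Gamma_n}\beta_\lambda^2\Big]+\frac{C_2}{n},$$ where $C_1>0$ depends only on $\gamma$, $c$ and $(\psi,\tilde\phi,\tilde\psi)$, and $C_2>0$, as well as the rank from which the inequality holds, depends only on $\gamma$, $c$, $c'$, $\|f\|_1$ and $(\psi,\tilde\phi,\tilde\psi)$. -/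

import Mathlib

open MeasureTheory ProbabilityTheory Filter Topology
open scoped ENNReal NNReal

noncomputable section

namespace PoissonWavelet

/-! ### Poisson processes on the real line -/

/-- The number of points of the random set `N` that lie in `A`. -/
def count {Ω : Type*} (N : Ω → Set ℝ) (A : Set ℝ) (ω : Ω) : ℕ∞ := (N ω ∩ A).encard

/-- The random countable set `N ⊆ ℝ` is a Poisson process with mean measure `μ`: the number of points
in every Borel set `A` is a random variable with the Poisson distribution of parameter `μ A` (almost
surely infinite if `μ A = ∞`), and the numbers of points in finitely many pairwise disjoint Borel
sets are independent. -/
structure IsPoissonProcess {Ω : Type*} [MeasurableSpace Ω] (P : Measure Ω) (N : Ω → Set ℝ)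
    (μ : Measure ℝ) : Prop where
  countable : ∀ ω, (N ω).Countable
  measurable_count : ∀ A, MeasurableSet A → Measurable (count N A)
  law : ∀ A, MeasurableSet A → μ A ≠ ∞ →
    P.map (count N A) = (poissonMeasure (μ A).toNNReal).map (fun k : ℕ => (k : ℕ∞))
  law_top : ∀ A, MeasurableSet A → μ A = ∞ → ∀ᵐ ω ∂P, count N A ω = ⊤
  indep : ∀ (m : ℕ) (A : Fin m → Set ℝ), (∀ i, MeasurableSet (A i)) →
    Pairwise (fun i j => Disjoint (A i) (A j)) → iIndepFun (fun i => count N (A i)) P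

/-- `∫ g dN = ∑_{T ∈ N} g(T)`. -/
def stochInt {Ω : Type*} (N : Ω → Set ℝ) (g : ℝ → ℝ) (ω : Ω) : ℝ := ∑' T : N ω, g T

/-! ### Biorthogonal wavelet bases -/

/-- The father wavelet for analysis, the indicator function of `[0, 1]`. -/
def father : ℝ → ℝ := Set.indicator (Set.Icc 0 1) 1

/-- `g` is piecewise constant: outside a finite set of break points, it takes the same value at any
two points that no break point separates. -/
def IsPiecewiseConstant (g : ℝ → ℝ) : Prop :=
  ∃ S : Finset ℝ, ∀ x y, x ≤ y → Disjoint (Set.Icc x y) (S : Set ℝ) → g x = g y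

/-- The Hölder condition of order `s > 0`: with `m` the largest integer smaller than `s`, the function
is `m` times continuously differentiable and its `m`-th derivative is Hölder continuous with
exponent `s - m ∈ (0, 1]`. (It is only used for compactly supported functions.) -/
def IsHolder (s : ℝ) (g : ℝ → ℝ) : Prop :=
  ContDiff ℝ ((⌈s⌉₊ - 1 : ℕ) : ℕ∞) g ∧
    ∃ C : ℝ, ∀ x y, |iteratedDeriv (⌈s⌉₊ - 1) g x - iteratedDeriv (⌈s⌉₊ - 1) g y|
      ≤ C * |x - y| ^ (s - ((⌈s⌉₊ - 1 : ℕ) : ℝ))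

/-- `x ↦ 2^{j/2} ψ(2^j x - k)`. -/
def dilate (ψ : ℝ → ℝ) (j k : ℤ) (x : ℝ) : ℝ :=
  (2 : ℝ) ^ ((j : ℝ) / 2) * ψ ((2 : ℝ) ^ j * x - k)

/-- The index set `Λ = {(j, k) : j ≥ -1, k ∈ ℤ}`. -/
abbrev Index : Type := {p : ℤ × ℤ // -1 ≤ p.1}

/-- The element of index `(j, k)` of the wavelet family generated by `φ` and `ψ`: the translate
`φ(x - k)` if `j = -1`, and `2^{j/2} ψ(2^j x - k)` if `j ≥ 0`. -/
def atom (φ ψ : ℝ → ℝ) (l : Index) (x : ℝ) : ℝ :=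
  if l.1.1 = -1 then φ (x - l.1.2) else dilate ψ l.1.1 l.1.2 x

/-- The coefficient `β_λ = ∫ φ_λ f`, for the analysis wavelets generated by `father` and `ψ`. -/
def coeff (ψ f : ℝ → ℝ) (l : Index) : ℝ := ∫ x, atom father ψ l x * f x

/-- `father`, `ψ` (analysis) and `φ'`, `ψ'` (reconstruction) generate a biorthogonal wavelet basis of
order `r ≥ 0`. For `r = 0` no regularity of `φ'` and `ψ'` is required beyond square integrability, so
that the Haar basis, in which `φ' = father` and `ψ' = ψ`, is included. The last field says that the
families form a basis: every function of `L²(ℝ)` has its wavelet decomposition. -/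
structure IsBiorthogonalWaveletBasis (r : ℝ) (ψ φ' ψ' : ℝ → ℝ) : Prop where
  order_nonneg : 0 ≤ r
  compact_φ' : HasCompactSupport φ'
  compact_ψ' : HasCompactSupport ψ'
  memLp_φ' : MemLp φ' 2 volume
  memLp_ψ' : MemLp ψ' 2 volume
  holder_φ' : 0 < r → IsHolder (r + 1) φ'
  holder_ψ' : 0 < r → IsHolder (r + 1) ψ'
  compact_ψ : HasCompactSupport ψ
  piecewise_ψ : IsPiecewiseConstant ψ
  moments_ψ : ∀ p : Polynomial ℝ, (p.natDegree : ℝ) ≤ r → ∫ x, ψ x * p.eval x = 0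
  biorthogonal : ∀ l l' : Index,
    ∫ x, atom father ψ l x * atom φ' ψ' l' x = if l = l' then 1 else 0
  decomposition : ∀ g : ℝ → ℝ, MemLp g 2 volume →
    Tendsto (fun F : Finset Index =>
      eLpNorm (fun x => g x - ∑ l ∈ F, coeff ψ g l * atom φ' ψ' l x) 2 volume) atTop (𝓝 0)

/-! ### The thresholding estimator -/

/-- The supremum norm `‖φ_λ‖_∞`. -/
def supNorm (ψ : ℝ → ℝ) (l : Index) : ℝ := ⨆ x, |atom father ψ l x|

/-- The estimator `β̂_λ = n⁻¹ ∫ φ_λ dN` of `β_λ`. -/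
def coeffHat {Ω : Type*} (ψ : ℝ → ℝ) (n : ℕ) (N : Ω → Set ℝ) (l : Index) (ω : Ω) : ℝ :=
  1 / n * stochInt N (atom father ψ l) ω

/-- `V_{λ,n} = n⁻¹ ∫ φ_λ² f`, the variance of `β̂_λ`. -/
def V (ψ f : ℝ → ℝ) (n : ℕ) (l : Index) : ℝ := 1 / n * ∫ x, atom father ψ l x ^ 2 * f x

/-- `V̂_{λ,n} = n⁻² ∫ φ_λ² dN`, the unbiased estimator of `V_{λ,n}`. -/
def VHat {Ω : Type*} (ψ : ℝ → ℝ) (n : ℕ) (N : Ω → Set ℝ) (l : Index) (ω : Ω) : ℝ :=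
  1 / (n : ℝ) ^ 2 * stochInt N (fun x => atom father ψ l x ^ 2) ω

/-- `Ṽ_{λ,n}`, which slightly overestimates `V_{λ,n}`. -/
def VTilde {Ω : Type*} (ψ : ℝ → ℝ) (γ : ℝ) (n : ℕ) (N : Ω → Set ℝ) (l : Index) (ω : Ω) : ℝ :=
  VHat ψ n N l ω
    + √(2 * γ * Real.log n * VHat ψ n N l ω * (supNorm ψ l ^ 2 / (n : ℝ) ^ 2))
    + 3 * γ * Real.log n * (supNorm ψ l ^ 2 / (n : ℝ) ^ 2)

/-- The random threshold `η_{λ,γ}`. -/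
def threshold {Ω : Type*} (ψ : ℝ → ℝ) (γ : ℝ) (n : ℕ) (N : Ω → Set ℝ) (l : Index) (ω : Ω) : ℝ :=
  √(2 * γ * VTilde ψ γ n N l ω * Real.log n) + γ * Real.log n / (3 * n) * supNorm ψ l

/-- `Γ = {(j, k) ∈ Λ : j ≤ j₀}`. -/
def levels (j₀ : ℤ) : Set Index := {l | l.1.1 ≤ j₀}

open Classical in
/-- The thresholded coefficient `β̃_λ`: it is `β̂_λ` if `|β̂_λ| ≥ η_{λ,γ}` and `λ ∈ Γ`, and `0`
otherwise. -/
def coeffTilde {Ω : Type*} (ψ : ℝ → ℝ) (γ : ℝ) (n : ℕ) (j₀ : ℤ) (N : Ω → Set ℝ) (l : Index)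
    (ω : Ω) : ℝ :=
  if threshold ψ γ n N l ω ≤ |coeffHat ψ n N l ω| ∧ l ∈ levels j₀ then coeffHat ψ n N l ω else 0

/-- The estimator `f̃_{n,γ} = ∑_λ β̃_λ φ̃_λ`. At each point only finitely many terms are nonzero. -/
def estimator {Ω : Type*} (ψ φ' ψ' : ℝ → ℝ) (γ : ℝ) (n : ℕ) (j₀ : ℤ) (N : Ω → Set ℝ) (ω : Ω)
    (x : ℝ) : ℝ :=
  ∑' l : Index, coeffTilde ψ γ n j₀ N l ω * atom φ' ψ' l x

/-- The risk `E ‖f̃_{n,γ} - f‖₂²`, an element of `[0, ∞]`. -/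
def risk {Ω : Type*} [MeasurableSpace Ω] (P : Measure Ω) (ψ φ' ψ' f : ℝ → ℝ) (γ : ℝ) (n : ℕ)
    (j₀ : ℤ) (N : Ω → Set ℝ) : ℝ≥0∞ :=
  ∫⁻ ω, eLpNorm (fun x => estimator ψ φ' ψ' γ n j₀ N ω x - f x) 2 volume ^ 2 ∂P

end PoissonWavelet

end

open PoissonWavelet

/-! The synthesis family satisfies an upper Riesz inequality (`exists_eLpNorm_sq_sum_le`), so the
risk is at most a constant times the sum over λ of E(β̃_λ - β_λ)². Outside Γ_n each term is exactly
β_λ². The work is to bound one term inside Γ_n with a remainder that can be summed over infinitely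
many positions k, although f may be unbounded with unbounded support.

Dividing by ‖φ_λ‖_∞ / n turns β̂_λ into B = ∫ y dN with |y| ≤ 1, and the threshold into a function h
of u = γ log n and W = ∫ y² dN. Write μ for the mean measure, l = log n, b = ∫ y dμ, v = ∫ y² dμ and
p = μ(y ≠ 0). Since the analysis wavelets take finitely many values, |y| ≥ c₀ > 0 wherever y ≠ 0,
hence c₀² p ≤ v ≤ p and |b| ≤ p. For the same reason ∫ y dN is a finite combination of independent
Poisson variables, which gives its Laplace transform and Bernstein bounds.

The target for one coefficient is C (min(b², v l) + p exp(-(c + d) l)) with d = (γ - c)/4; this is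
`exists_coefficient_risk_bound`. The factor p in the remainder is what makes it summable. There are
two regimes. If p exp(d l) ≤ 1, keeping the coefficient forces at least u/3 points into the support
of y, an event whose weighted probability is tiny and proportional to p
(`lintegral_error_le_of_small`); otherwise the error is b², comparable to the minimum. If p exp(d l)
> 1, the error is at most a constant times min(b², h²), plus (B - b)² on the event |B - b| > κ h
with κ < 1 (`thresholded_error_le`). That event requires a Bernstein deviation of B, or a deviation
of W below v (`lt_or_lt_of_normThreshold_lt`), and has probability of order exp(-κ² u). A factor
exp(-d l) is then traded for p.

At each level a point lies in boundedly many supports and ‖φ_λ‖_∞² is at most a constant times 2^j,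
so the remainders add up to a constant times n⁻² · 2^{j₀} · n ‖f‖₁ · n^{-(c + d)}. This is O(1/n),
because 2^{j₀} ≤ n^c (log n)^{c'} ≤ n^{c + d} for large n. -/

/-! ### Laplace functional of a Poisson process on functions with finite range. -/

theorem hasSum_exp_mul_poisson (r t : ℝ) :
    HasSum (fun k : ℕ => Real.exp (-r) * r ^ k / (k.factorial : ℝ) * Real.exp (t * k))
      (Real.exp (r * (Real.exp t - 1))) := by
  have h := (NormedSpace.expSeries_div_hasSum_exp (r * Real.exp t : ℝ)).mul_left (Real.exp (-r))
  rw [← Real.exp_eq_exp_ℝ, ← Real.exp_add] at h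
  have h2 : r * (Real.exp t - 1) = -r + r * Real.exp t := by ring
  rw [h2]
  refine h.congr_fun fun k => ?_
  rw [mul_pow, ← Real.exp_nat_mul, mul_comm t]
  ring

theorem integral_comp_of_finite_range {α : Type*} [MeasurableSpace α] {μ : Measure α}
    [IsFiniteMeasure μ] {g : α → ℝ} (hg : Measurable g) {s : Finset ℝ} (hs : ∀ x, g x ∈ s)
    (F : ℝ → ℝ) : ∫ x, F (g x) ∂μ = ∑ v ∈ s, μ.real (g ⁻¹' {v}) * F v := by
  classical
  have h1 : ∀ x, F (g x) = ∑ v ∈ s, (g ⁻¹' {v}).indicator (fun _ => F v) x := by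
    intro x
    rw [Finset.sum_eq_single (g x)]
    · simp
    · intro v _ hv
      exact Set.indicator_of_notMem (fun h => hv h.symm) _
    · exact fun h => absurd (hs x) h
  have hm : ∀ v, MeasurableSet (g ⁻¹' {v}) := fun v => hg (measurableSet_singleton v)
  simp_rw [h1]
  rw [integral_finsetSum]
  · refine Finset.sum_congr rfl fun v _ => ?_
    rw [integral_indicator_const _ (hm v), smul_eq_mul]
  · intro v _
    exact (integrable_const _).indicator (hm v)

theorem integrable_comp_of_finite_range {α : Type*} [MeasurableSpace α] {μ : Measure α}
    [IsFiniteMeasure μ] {g : α → ℝ} (hg : Measurable g) (hs : (Set.range g).Finite) :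
    Integrable g μ := by
  obtain ⟨C, hC⟩ := (hs.isBounded).exists_norm_le
  exact Integrable.of_bound hg.aestronglyMeasurable C (ae_of_all _ fun x => hC _ ⟨x, rfl⟩)

/-- Groups the points by the value of g, which reduces stochastic integrals to counts on disjoint
level sets. Finiteness of N ω keeps both `tsum` and `ENat.toNat` away from their default values. -/
theorem stochInt_eq_sum {Ω : Type*} {N : Ω → Set ℝ} {g : ℝ → ℝ} {s : Finset ℝ}
    (hs : ∀ x, g x ∈ s) {ω : Ω} (hω : (N ω).Finite) :
    stochInt N g ω = ∑ v ∈ s, v * ((count N (g ⁻¹' {v}) ω).toNat : ℝ) := by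
  classical
  have h1 : stochInt N g ω = ∑ T ∈ hω.toFinset, g T := by
    unfold stochInt
    rw [← Finset.tsum_subtype]
    exact tsum_congr_set_coe g (by simp)
  rw [h1, ← Finset.sum_fiberwise_of_maps_to (s := hω.toFinset) (t := s) (g := g) (fun x _ => hs x)]
  refine Finset.sum_congr rfl fun v _ => ?_
  have h2 : N ω ∩ g ⁻¹' {v} = ((hω.toFinset.filter fun x => g x = v : Finset ℝ) : Set ℝ) := by
    ext x; simp
  rw [Finset.sum_congr rfl (g := fun _ => v) (fun x hx => (Finset.mem_filter.1 hx).2)]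
  simp only [count, h2, Set.encard_coe_eq_coe_finsetCard, ENat.toNat_natCast, Finset.sum_const,
    nsmul_eq_mul]
  ring

section PointProcess

variable {Ω : Type*} [MeasurableSpace Ω] {P : Measure Ω} {N : Ω → Set ℝ} {μ : Measure ℝ}
  [IsFiniteMeasure μ]

theorem ae_finite_of_isPoissonProcess (h : IsPoissonProcess P N μ) : ∀ᵐ ω ∂P, (N ω).Finite := by
  have h1 := h.law Set.univ MeasurableSet.univ (measure_ne_top _ _)
  have h2 : P.map (count N Set.univ) {⊤} = 0 := by
    rw [h1, Measure.map_apply Measurable.of_discrete (measurableSet_singleton _)]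
    have h0 : (fun k : ℕ => (k : ℕ∞)) ⁻¹' {⊤} = ∅ := by ext k; simp
    rw [h0, measure_empty]
  rw [Measure.map_apply (h.measurable_count _ MeasurableSet.univ) (measurableSet_singleton _)] at h2
  rw [ae_iff]
  refine measure_mono_null (fun ω hω => ?_) h2
  simpa [count] using hω

theorem mgf_count (h : IsPoissonProcess P N μ) {A : Set ℝ} (hA : MeasurableSet A) (t : ℝ) :
    Integrable (fun ω => Real.exp (t * ((count N A ω).toNat : ℝ))) P ∧
    ∫ ω, Real.exp (t * ((count N A ω).toNat : ℝ)) ∂P = Real.exp (μ.real A * (Real.exp t - 1)) := by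
  have hl := h.law A hA (measure_ne_top _ _)
  have hm := h.measurable_count A hA
  -- The value at `⊤` is immaterial: the law of the count is carried by ℕ.
  set F : ℕ∞ → ℝ := fun k => Real.exp (t * (k.toNat : ℝ)) with hF
  have hs := hasSum_exp_mul_poisson (μ.real A) t
  have hr : (((μ A).toNNReal : ℝ≥0) : ℝ) = μ.real A := rfl
  have hint : Integrable (fun k : ℕ => F (k : ℕ∞)) (poissonMeasure (μ A).toNNReal) := by
    rw [integrable_poissonMeasure_iff, hr]
    refine hs.summable.congr fun k => ?_
    simp [hF]
  have hint2 : Integrable F (P.map (count N A)) := by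
    rw [hl, integrable_map_measure Measurable.of_discrete.aestronglyMeasurable
      Measurable.of_discrete.aemeasurable]
    exact hint
  constructor
  · exact (integrable_map_measure Measurable.of_discrete.aestronglyMeasurable
      hm.aemeasurable).1 hint2
  · have h3 : ∫ ω, F (count N A ω) ∂P = ∫ k, F k ∂(P.map (count N A)) :=
      (integral_map hm.aemeasurable Measurable.of_discrete.aestronglyMeasurable).symm
    change ∫ ω, F (count N A ω) ∂P = _
    rw [h3, hl, integral_map Measurable.of_discrete.aemeasurable
      Measurable.of_discrete.aestronglyMeasurable, integral_poissonMeasure, hr, ← hs.tsum_eq]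
    refine tsum_congr fun k => ?_
    simp [hF]

theorem aemeasurable_stochInt (h : IsPoissonProcess P N μ) {g : ℝ → ℝ} (hg : Measurable g)
    (hs : (Set.range g).Finite) : AEMeasurable (stochInt N g) P := by
  refine ⟨fun ω => ∑ v ∈ hs.toFinset, v * ((count N (g ⁻¹' {v}) ω).toNat : ℝ), ?_, ?_⟩
  · refine Finset.measurable_sum _ fun v _ => Measurable.const_mul ?_ v
    exact (Measurable.of_discrete (f := fun k : ℕ∞ => (k.toNat : ℝ))).comp
      (h.measurable_count _ (hg (measurableSet_singleton v)))
  · filter_upwards [ae_finite_of_isPoissonProcess h] with ω hω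
    exact stochInt_eq_sum (fun x => by simp) hω

/-- The level sets of g are finitely many and disjoint, so ∫ g dN is a combination of independent
Poisson counts and its exponential moment is a product of Poisson ones. -/
theorem laplace_functional [IsProbabilityMeasure P] (h : IsPoissonProcess P N μ) {g : ℝ → ℝ}
    (hg : Measurable g) (hs : (Set.range g).Finite) :
    Integrable (fun ω => Real.exp (stochInt N g ω)) P ∧
    ∫ ω, Real.exp (stochInt N g ω) ∂P = Real.exp (∫ x, (Real.exp (g x) - 1) ∂μ) := by
  classical
  set s := hs.toFinset
  have hs' : ∀ x, g x ∈ s := fun x => by simp [s]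
  let e := s.equivFin
  let A : Fin s.card → Set ℝ := fun i => g ⁻¹' {((e.symm i : s) : ℝ)}
  have hA : ∀ i, MeasurableSet (A i) := fun i => hg (measurableSet_singleton _)
  have hd : Pairwise (fun i j => Disjoint (A i) (A j)) := by
    intro i j hij
    rw [Set.disjoint_left]
    intro x hx hx'
    apply hij
    have : ((e.symm i : s) : ℝ) = ((e.symm j : s) : ℝ) := by
      rw [← Set.mem_singleton_iff.1 hx, ← Set.mem_singleton_iff.1 hx']
    exact e.symm.injective (Subtype.ext this)
  let X : Fin s.card → Ω → ℝ := fun i ω => ((e.symm i : s) : ℝ) * ((count N (A i) ω).toNat : ℝ)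
  have hXi : iIndepFun X P :=
    (h.indep _ A hA hd).comp (fun i k => ((e.symm i : s) : ℝ) * ((k : ℕ∞).toNat : ℝ))
      fun i => Measurable.of_discrete
  have hXm : ∀ i, Measurable (X i) := fun i =>
    (Measurable.of_discrete (f := fun k : ℕ∞ => ((e.symm i : s) : ℝ) * (k.toNat : ℝ))).comp
      (h.measurable_count _ (hA i))
  have hae : (fun ω => Real.exp (stochInt N g ω)) =ᵐ[P]
      fun ω => Real.exp (1 * (∑ i, X i) ω) := by
    filter_upwards [ae_finite_of_isPoissonProcess h] with ω hω
    rw [stochInt_eq_sum hs' hω, one_mul, Finset.sum_apply, ← Finset.sum_coe_sort s]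
    congr 1
    exact (Equiv.sum_comp e.symm
      (fun v : s => (v : ℝ) * ((count N (g ⁻¹' {(v : ℝ)}) ω).toNat : ℝ))).symm
  constructor
  · refine Integrable.congr ?_ hae.symm
    refine hXi.integrable_exp_mul_sum hXm fun i _ => ?_
    simp only [one_mul]
    exact (mgf_count h (hA i) _).1
  · rw [integral_congr_ae hae]
    change mgf (∑ i, X i) P 1 = _
    rw [hXi.mgf_sum hXm, integral_comp_of_finite_range hg hs' (fun v => Real.exp v - 1),
      Real.exp_sum, ← Finset.prod_coe_sort s]
    rw [← Equiv.prod_comp e.symm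
      (fun v : s => Real.exp (μ.real (g ⁻¹' {(v : ℝ)}) * (Real.exp (v : ℝ) - 1)))]
    refine Finset.prod_congr rfl fun i _ => ?_
    simp only [mgf, one_mul]
    exact (mgf_count h (hA i) _).2

end PointProcess

/-! ### Elementary exponential bounds and properties of the stochastic integral. -/

/-- Since (k + 2)! ≥ 2 · 3^k, the tail of the exponential series is dominated by a geometric series
of ratio a / 3. -/
theorem exp_le_one_add_add_sq_div {a t : ℝ} (ha : a < 3) (ht : |t| ≤ a) :
    Real.exp t ≤ 1 + t + t ^ 2 / (2 * (1 - a / 3)) := by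
  have ha0 : 0 ≤ a := (abs_nonneg t).trans ht
  have h := NormedSpace.expSeries_div_hasSum_exp (t : ℝ)
  rw [← Real.exp_eq_exp_ℝ] at h
  have h2 := (hasSum_nat_add_iff' (f := fun n : ℕ => t ^ n / (n.factorial : ℝ)) 2).2 h
  have hg := (hasSum_geometric_of_lt_one (r := a / 3) (by positivity) (by linarith)).mul_left
    (t ^ 2 / 2)
  have hle := hasSum_le (fun k => ?_) h2 hg
  · simp only [Finset.sum_range_succ, Finset.sum_range_zero, pow_zero, Nat.factorial, pow_one] at hle
    have h3 : t ^ 2 / (2 * (1 - a / 3)) = t ^ 2 / 2 * (1 - a / 3)⁻¹ := by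
      rw [← div_div, div_eq_mul_inv (t ^ 2 / 2)]
    rw [h3]
    push_cast at hle
    linarith
  · have h4 : ((2 : ℝ) * 3 ^ k) ≤ ((k + 2).factorial : ℝ) := by
      have := Nat.factorial_mul_pow_le_factorial (m := 2) (n := k)
      rw [add_comm k 2]
      exact_mod_cast this
    calc t ^ (k + 2) / ((k + 2).factorial : ℝ) ≤ |t| ^ (k + 2) / ((k + 2).factorial : ℝ) := by
          exact div_le_div_of_nonneg_right ((le_abs_self _).trans (by rw [abs_pow]))
            (Nat.cast_nonneg _)
      _ ≤ |t| ^ (k + 2) / (2 * 3 ^ k) := by gcongr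
      _ = t ^ 2 / 2 * (|t| / 3) ^ k := by rw [pow_add, sq_abs, div_pow]; field_simp
      _ ≤ t ^ 2 / 2 * (a / 3) ^ k := by gcongr

theorem exp_neg_le_quadratic {t : ℝ} (ht : 0 ≤ t) : Real.exp (-t) ≤ 1 - t + t ^ 2 / 2 := by
  have h1 := Real.quadratic_le_exp_of_nonneg ht
  have h2 : Real.exp (-t) * Real.exp t = 1 := by rw [← Real.exp_add]; simp
  -- The product equals 1 + t⁴ / 4.
  have h3 : (1 + t + t ^ 2 / 2) * (1 - t + t ^ 2 / 2) ≥ 1 := by nlinarith [sq_nonneg (t ^ 2)]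
  have h5 : 0 ≤ 1 - t + t ^ 2 / 2 := by nlinarith [sq_nonneg (t - 1)]
  have h4 : Real.exp (-t) * (1 + t + t ^ 2 / 2) ≤ (1 - t + t ^ 2 / 2) * (1 + t + t ^ 2 / 2) := by
    calc _ ≤ Real.exp (-t) * Real.exp t := by gcongr
      _ ≤ _ := by linarith
  exact le_of_mul_le_mul_right h4 (by positivity)

/-- Only the majorant Z has to be integrable; X may be any function. Deviation events are therefore
handled by dominating their indicators with exponentials. -/
theorem lintegral_ofReal_le_of_le {Ω : Type*} [MeasurableSpace Ω] {P : Measure Ω} {X Z : Ω → ℝ}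
    {e : ℝ} (hZ : Integrable Z P) (hZ0 : 0 ≤ᵐ[P] Z) (h : X ≤ᵐ[P] Z) (he : ∫ ω, Z ω ∂P ≤ e) :
    ∫⁻ ω, ENNReal.ofReal (X ω) ∂P ≤ ENNReal.ofReal e := by
  calc ∫⁻ ω, ENNReal.ofReal (X ω) ∂P ≤ ∫⁻ ω, ENNReal.ofReal (Z ω) ∂P :=
        lintegral_mono_ae (h.mono fun ω hω => ENNReal.ofReal_le_ofReal hω)
    _ = ENNReal.ofReal (∫ ω, Z ω ∂P) := (ofReal_integral_eq_lintegral_ofReal hZ hZ0).symm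
    _ ≤ _ := ENNReal.ofReal_le_ofReal he

theorem stochInt_nonneg {Ω : Type*} {N : Ω → Set ℝ} {g : ℝ → ℝ} (hg : ∀ x, 0 ≤ g x) (ω : Ω) :
    0 ≤ stochInt N g ω := tsum_nonneg fun _ => hg _

theorem stochInt_const_mul {Ω : Type*} {N : Ω → Set ℝ} {g : ℝ → ℝ} (t : ℝ) (ω : Ω) :
    stochInt N (fun x => t * g x) ω = t * stochInt N g ω := tsum_mul_left

theorem abs_stochInt_le {Ω : Type*} {N : Ω → Set ℝ} {g g' : ℝ → ℝ} (h : ∀ x, |g x| ≤ g' x)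
    {ω : Ω} (hω : (N ω).Finite) : |stochInt N g ω| ≤ stochInt N g' ω := by
  have := hω.fintype
  unfold stochInt
  rw [tsum_fintype, tsum_fintype]
  exact (Finset.abs_sum_le_sum_abs _ _).trans (Finset.sum_le_sum fun T _ => h _)

theorem finite_range_comp {g : ℝ → ℝ} (hs : (Set.range g).Finite) (F : ℝ → ℝ) :
    (Set.range fun x => F (g x)).Finite := by
  refine (hs.image F).subset ?_
  rintro _ ⟨x, rfl⟩
  exact ⟨g x, ⟨x, rfl⟩, rfl⟩

/-! ### Exponential moments and Bernstein-type deviations. -/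

section PointProcess

variable {Ω : Type*} [MeasurableSpace Ω] {P : Measure Ω} [IsProbabilityMeasure P]
  {N : Ω → Set ℝ} {μ : Measure ℝ} [IsFiniteMeasure μ]

theorem integrable_exp_stochInt (h : IsPoissonProcess P N μ) {g : ℝ → ℝ}
    (hg : Measurable g) (hs : (Set.range g).Finite) (t : ℝ) :
    Integrable (fun ω => Real.exp (t * stochInt N g ω)) P := by
  simp_rw [← stochInt_const_mul]
  exact (laplace_functional h (hg.const_mul t) (finite_range_comp hs (fun v => t * v))).1

theorem integral_exp_stochInt (h : IsPoissonProcess P N μ) {g : ℝ → ℝ}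
    (hg : Measurable g) (hs : (Set.range g).Finite) (t : ℝ) :
    ∫ ω, Real.exp (t * stochInt N g ω) ∂P = Real.exp (∫ x, (Real.exp (t * g x) - 1) ∂μ) := by
  simp_rw [← stochInt_const_mul]
  exact (laplace_functional h (hg.const_mul t) (finite_range_comp hs (fun v => t * v))).2

theorem integral_exp_stochInt_le (h : IsPoissonProcess P N μ) {y : ℝ → ℝ}
    (hy : Measurable y) (hs : (Set.range y).Finite) (hy1 : ∀ x, |y x| ≤ 1) {t : ℝ} (ht : |t| < 3) :
    ∫ ω, Real.exp (t * stochInt N y ω) ∂P ≤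
      Real.exp (t * ∫ x, y x ∂μ + t ^ 2 * (∫ x, y x ^ 2 ∂μ) / (2 * (1 - |t| / 3))) := by
  rw [integral_exp_stochInt h hy hs]
  gcongr
  have i1 : Integrable y μ := integrable_comp_of_finite_range hy hs
  have i2 : Integrable (fun x => y x ^ 2) μ :=
    integrable_comp_of_finite_range (hy.pow_const 2) (finite_range_comp hs (fun v => v ^ 2))
  have i3 : Integrable (fun x => Real.exp (t * y x) - 1) μ :=
    integrable_comp_of_finite_range (by fun_prop)
      (finite_range_comp hs (fun v => Real.exp (t * v) - 1))
  calc ∫ x, (Real.exp (t * y x) - 1) ∂μ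
      ≤ ∫ x, (t * y x + t ^ 2 / (2 * (1 - |t| / 3)) * y x ^ 2) ∂μ := by
        refine integral_mono i3 ((i1.const_mul t).add (i2.const_mul _)) fun x => ?_
        have h1 : |t * y x| ≤ |t| := by
          rw [abs_mul]; exact mul_le_of_le_one_right (abs_nonneg _) (hy1 x)
        have := exp_le_one_add_add_sq_div ht h1
        rw [mul_pow] at this
        have h3 : t ^ 2 * y x ^ 2 / (2 * (1 - |t| / 3)) = t ^ 2 / (2 * (1 - |t| / 3)) * y x ^ 2 := by
          ring
        simp only
        linarith
    _ = _ := by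
        rw [integral_add (i1.const_mul t) (i2.const_mul _), integral_const_mul, integral_const_mul]
        ring

/-- Chernoff bound in exponential form, for the deviations of Bernstein's inequality. -/
theorem bernstein_exp (h : IsPoissonProcess P N μ) {y : ℝ → ℝ}
    (hy : Measurable y) (hs : (Set.range y).Finite) (hy1 : ∀ x, |y x| ≤ 1) {α β ε : ℝ}
    (hα : 0 < α) (hβ : 0 < β) (hv : ∫ x, y x ^ 2 ∂μ = β ^ 2) (hε : |ε| = 1) :
    ∫ ω, Real.exp (3 * α / (α + 3 * β) *
      (ε * (stochInt N y ω - ∫ x, y x ∂μ) - (α * β + α ^ 2 / 6))) ∂P ≤ Real.exp (-(α ^ 2 / 2)) := by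
  -- With this Chernoff parameter 1 - a / 3 = 3β / (α + 3β), and the exponent is exactly -α² / 2.
  set a := 3 * α / (α + 3 * β) with ha
  set b := ∫ x, y x ∂μ
  have ha0 : 0 < a := by positivity
  have ha3 : a < 3 := by rw [ha, div_lt_iff₀ (by positivity)]; linarith
  have haε : |a * ε| = a := by rw [abs_mul, hε, mul_one, abs_of_pos ha0]
  have hε2 : ε ^ 2 = 1 := by rw [← sq_abs, hε, one_pow]
  have e1 : ∀ ω, Real.exp (a * (ε * (stochInt N y ω - b) - (α * β + α ^ 2 / 6))) =
      Real.exp (a * ε * stochInt N y ω) * Real.exp (-(a * ε * b) - a * (α * β + α ^ 2 / 6)) := by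
    intro ω; rw [← Real.exp_add]; congr 1; ring
  simp_rw [e1]
  rw [integral_mul_const]
  calc _ ≤ Real.exp (a * ε * b + (a * ε) ^ 2 * β ^ 2 / (2 * (1 - a / 3))) *
        Real.exp (-(a * ε * b) - a * (α * β + α ^ 2 / 6)) := by
        gcongr
        have := integral_exp_stochInt_le h hy hs hy1 (t := a * ε) (by rw [haε]; exact ha3)
        rwa [haε, hv] at this
    _ = _ := by
        rw [← Real.exp_add]
        congr 1
        have h1 : 1 - a / 3 = 3 * β / (α + 3 * β) := by rw [ha]; field_simp; ring
        rw [mul_pow, hε2, h1, ha]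
        field_simp
        ring

/-- The lower tail of ∫ y² dN is sub-Gaussian, without a Bernstein correction, because exp(-t) ≤ 1 -
t + t² / 2 for t ≥ 0 and y⁴ ≤ y². The parameter α / β gives the exponent -α² / 2. -/
theorem integral_exp_neg_sq_le (h : IsPoissonProcess P N μ) {y : ℝ → ℝ}
    (hy : Measurable y) (hs : (Set.range y).Finite) (hy1 : ∀ x, |y x| ≤ 1) {α β : ℝ}
    (hα : 0 < α) (hβ : 0 < β) (hv : ∫ x, y x ^ 2 ∂μ = β ^ 2) :
    ∫ ω, Real.exp (-(α / β) * (stochInt N (fun x => y x ^ 2) ω - β ^ 2 + α * β)) ∂P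
      ≤ Real.exp (-(α ^ 2 / 2)) := by
  set a := α / β with ha
  have ha0 : 0 < a := by positivity
  have e1 : ∀ ω, Real.exp (-a * (stochInt N (fun x => y x ^ 2) ω - β ^ 2 + α * β)) =
      Real.exp (-a * stochInt N (fun x => y x ^ 2) ω) * Real.exp (a * β ^ 2 - a * (α * β)) := by
    intro ω; rw [← Real.exp_add]; congr 1; ring
  simp_rw [e1]
  have hm : Measurable fun x => y x ^ 2 := hy.pow_const 2
  have hf := finite_range_comp hs (fun v => v ^ 2)
  rw [integral_mul_const, integral_exp_stochInt h hm hf, ← Real.exp_add]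
  gcongr
  have i2 : Integrable (fun x => y x ^ 2) μ := integrable_comp_of_finite_range hm hf
  have i3 : Integrable (fun x => Real.exp (-a * y x ^ 2) - 1) μ :=
    integrable_comp_of_finite_range (by fun_prop)
      (finite_range_comp hs (fun v => Real.exp (-a * v ^ 2) - 1))
  have h2 : ∫ x, (Real.exp (-a * y x ^ 2) - 1) ∂μ ≤ ∫ x, (-a + a ^ 2 / 2) * y x ^ 2 ∂μ := by
    refine integral_mono i3 (i2.const_mul _) fun x => ?_
    have h1 := exp_neg_le_quadratic (t := a * y x ^ 2) (by positivity)
    have h4 : y x ^ 2 ≤ 1 := by rw [← sq_abs]; exact pow_le_one₀ (abs_nonneg _) (hy1 x)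
    have h3 : (a * y x ^ 2) ^ 2 ≤ a ^ 2 * y x ^ 2 := by
      rw [mul_pow]
      exact mul_le_mul_of_nonneg_left (by nlinarith [sq_nonneg (y x)]) (sq_nonneg a)
    simp only
    rw [neg_mul]
    linarith
  rw [integral_const_mul, hv] at h2
  have h5 : (-a + a ^ 2 / 2) * β ^ 2 + (a * β ^ 2 - a * (α * β)) = -(α ^ 2 / 2) := by
    rw [ha]; field_simp; ring
  linarith

/-- The factor 2 comes from the Laplace functional: exp(s) - 1 ≤ 2s on [0, 1] gives E exp(W) ≤
exp(2v), and W + 1 - 2v ≤ exp(W - 2v) then bounds E W. -/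
theorem integrable_stochInt_sq (h : IsPoissonProcess P N μ) {y : ℝ → ℝ}
    (hy : Measurable y) (hs : (Set.range y).Finite) (hy1 : ∀ x, |y x| ≤ 1) :
    Integrable (stochInt N (fun x => y x ^ 2)) P ∧
    ∫ ω, stochInt N (fun x => y x ^ 2) ω ∂P ≤ 2 * ∫ x, y x ^ 2 ∂μ := by
  have hm : Measurable fun x => y x ^ 2 := hy.pow_const 2
  have hf := finite_range_comp hs (fun v => v ^ 2)
  have i2 : Integrable (fun x => y x ^ 2) μ := integrable_comp_of_finite_range hm hf
  have i3 : Integrable (fun x => Real.exp (1 * y x ^ 2) - 1) μ :=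
    integrable_comp_of_finite_range (by fun_prop)
      (finite_range_comp hs (fun v => Real.exp (1 * v ^ 2) - 1))
  have hI := integrable_exp_stochInt h hm hf 1
  have hle : ∀ ω, stochInt N (fun x => y x ^ 2) ω + 1 ≤
      Real.exp (1 * stochInt N (fun x => y x ^ 2) ω) := fun ω => by
    rw [one_mul]; exact Real.add_one_le_exp _
  have hW0 : ∀ ω, 0 ≤ stochInt N (fun x => y x ^ 2) ω := stochInt_nonneg fun x => sq_nonneg _
  have hW : Integrable (stochInt N (fun x => y x ^ 2)) P := by
    refine hI.mono' (aemeasurable_stochInt h hm hf).aestronglyMeasurable (ae_of_all _ fun ω => ?_)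
    rw [Real.norm_of_nonneg (hW0 ω)]
    linarith [hle ω]
  refine ⟨hW, ?_⟩
  set v := ∫ x, y x ^ 2 ∂μ
  have h1 : ∫ ω, Real.exp (1 * stochInt N (fun x => y x ^ 2) ω) ∂P ≤ Real.exp (2 * v) := by
    rw [integral_exp_stochInt h hm hf]
    gcongr
    rw [← integral_const_mul]
    refine integral_mono i3 (i2.const_mul _) fun x => ?_
    have h4 : y x ^ 2 ≤ 1 := by rw [← sq_abs]; exact pow_le_one₀ (abs_nonneg _) (hy1 x)
    have h0 : 0 ≤ y x ^ 2 := sq_nonneg _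
    have := exp_le_one_add_add_sq_div (a := 1) (t := y x ^ 2) (by norm_num)
      (by rwa [abs_of_nonneg h0])
    norm_num at this
    simp only [one_mul]
    nlinarith
  have h2 : ∫ ω, (stochInt N (fun x => y x ^ 2) ω + (1 - 2 * v)) ∂P ≤
      ∫ ω, Real.exp (1 * stochInt N (fun x => y x ^ 2) ω) * Real.exp (-(2 * v)) ∂P := by
    refine integral_mono (hW.add (integrable_const _)) (hI.mul_const _) fun ω => ?_
    simp only
    rw [← Real.exp_add, one_mul]
    linarith [Real.add_one_le_exp (stochInt N (fun x => y x ^ 2) ω + -(2 * v))]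
  rw [integral_mul_const, integral_add hW (integrable_const _)] at h2
  simp only [integral_const, probReal_univ, one_smul] at h2
  have h3 : (∫ ω, Real.exp (1 * stochInt N (fun x => y x ^ 2) ω) ∂P) * Real.exp (-(2 * v)) ≤ 1 := by
    calc _ ≤ Real.exp (2 * v) * Real.exp (-(2 * v)) := by gcongr
      _ = 1 := by rw [← Real.exp_add]; simp
  linarith

end PointProcess

/-! ### Deterministic analysis of thresholding. -/

/-- The random threshold of the normalised problem, as a function of `u = γ log n` and of the
normalised estimator of the variance. -/
noncomputable def normThreshold (u W : ℝ) : ℝ := √(2 * u * (W + √(2 * u * W) + 3 * u)) + u / 3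

theorem normThreshold_ge {u W : ℝ} : u / 3 ≤ normThreshold u W := by
  unfold normThreshold; linarith [Real.sqrt_nonneg (2 * u * (W + √(2 * u * W) + 3 * u))]

theorem normThreshold_sq_le {u W : ℝ} (hu : 0 ≤ u) (hW : 0 ≤ W) :
    normThreshold u W ^ 2 ≤ 8 * u * W + 17 * u ^ 2 := by
  unfold normThreshold
  have h1 : √(2 * u * W) ≤ u + W / 2 := by
    rw [Real.sqrt_le_left (by positivity)]
    nlinarith [sq_nonneg (u - W / 2)]
  have h2 : √(2 * u * (W + √(2 * u * W) + 3 * u)) ^ 2 ≤ 2 * u * (3 / 2 * W + 4 * u) := by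
    rw [Real.sq_sqrt (by positivity)]
    exact mul_le_mul_of_nonneg_left (by linarith) (by positivity)
  have h3 := add_sq_le (a := √(2 * u * (W + √(2 * u * W) + 3 * u))) (b := u / 3)
  nlinarith [mul_nonneg hu hW, sq_nonneg u]

open Classical in
-- If |B - b| ≤ κ h, keeping B means |b| ≥ (1 - κ) h with error at most h, and killing it means |b|
-- ≤ 2h with error |b|: either way the minimum dominates. If |B - b| > κ h, killing B costs |b| ≤ h
-- + |B - b| ≤ (2/κ) |B - b|.
theorem thresholded_error_le {B b h κ : ℝ} (hκ : 0 < κ) (hκ1 : κ < 1) (hh : 0 ≤ h) :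
    ((if h ≤ |B| then B else 0) - b) ^ 2 ≤ 4 / (1 - κ) ^ 2 * min (b ^ 2) (h ^ 2) +
      4 / κ ^ 2 * ((B - b) ^ 2 * if κ * h < |B - b| then 1 else 0) := by
  have hk : 0 < 1 - κ := by linarith
  have tri : |b| ≤ |B| + |B - b| := by
    have := abs_sub B (B - b); rwa [sub_sub_cancel] at this
  have tri2 : |B| ≤ |b| + |B - b| := by
    have := abs_add_le b (B - b); rwa [add_sub_cancel] at this
  have hm0 : 0 ≤ min (b ^ 2) (h ^ 2) := le_min (sq_nonneg _) (sq_nonneg _)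
  have hA : (1 : ℝ) ≤ 1 / (1 - κ) ^ 2 := by
    rw [le_div_iff₀ (by positivity), one_mul]; exact pow_le_one₀ hk.le (by linarith)
  have hA4 : 4 / (1 - κ) ^ 2 = 4 * (1 / (1 - κ) ^ 2) := by ring
  have hB : (1 : ℝ) ≤ 1 / κ ^ 2 := by
    rw [le_div_iff₀ (by positivity), one_mul]; exact pow_le_one₀ hκ.le hκ1.le
  have hB4 : 4 / κ ^ 2 = 4 * (1 / κ ^ 2) := by ring
  by_cases hbad : κ * h < |B - b|
  · simp only [hbad, if_true, mul_one]
    have hY0 : 0 ≤ (B - b) ^ 2 := sq_nonneg _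
    have h0 : 0 ≤ 4 / (1 - κ) ^ 2 * min (b ^ 2) (h ^ 2) := by positivity
    suffices hs : ((if h ≤ |B| then B else 0) - b) ^ 2 ≤ 4 / κ ^ 2 * (B - b) ^ 2 by linarith
    split_ifs with hk1
    · rw [hB4]; nlinarith
    · have h1 : |b| ≤ 2 / κ * |B - b| := by
        have h2 : h ≤ |B - b| / κ := by rw [le_div_iff₀ hκ]; linarith
        have h3 : |B - b| ≤ |B - b| / κ := by
          rw [le_div_iff₀ hκ]; nlinarith [abs_nonneg (B - b)]
        have h4 : 2 / κ * |B - b| = 2 * (|B - b| / κ) := by ring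
        linarith
      calc (0 - b) ^ 2 = |b| ^ 2 := by rw [zero_sub, neg_sq, sq_abs]
        _ ≤ (2 / κ * |B - b|) ^ 2 := by gcongr
        _ = _ := by rw [mul_pow, div_pow, sq_abs]; norm_num
  · simp only [hbad, if_false, mul_zero, add_zero]
    push Not at hbad
    split_ifs with hk1
    · have h1 : (1 - κ) * h ≤ |b| := by linarith
      have h2 : h ^ 2 ≤ 1 / (1 - κ) ^ 2 * b ^ 2 := by
        rw [one_div, ← div_eq_inv_mul, le_div_iff₀ (by positivity), ← mul_pow, ← sq_abs b]
        gcongr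
        linarith
      have h3 : (B - b) ^ 2 ≤ h ^ 2 := by
        rw [← sq_abs]; gcongr; nlinarith
      have h4 : h ^ 2 ≤ 1 / (1 - κ) ^ 2 * min (b ^ 2) (h ^ 2) := by
        rcases min_choice (b ^ 2) (h ^ 2) with hc | hc <;> rw [hc]
        · exact h2
        · nlinarith [sq_nonneg h]
      rw [hA4]
      nlinarith
    · have h1 : |b| ≤ 2 * h := by nlinarith
      have h2 : b ^ 2 ≤ 4 * h ^ 2 := by
        rw [← sq_abs b]; calc |b| ^ 2 ≤ (2 * h) ^ 2 := by gcongr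
          _ = _ := by ring
      have h4 : b ^ 2 ≤ 4 * min (b ^ 2) (h ^ 2) := by
        rcases min_choice (b ^ 2) (h ^ 2) with hc | hc <;> rw [hc]
        · linarith [sq_nonneg b]
        · exact h2
      rw [zero_sub, neg_sq, hA4]
      nlinarith

/-- With u = a² / 2 and β² the true variance, the first alternative is Bernstein's deviation at
level κ² u. If W is not too small, β² ≤ W + aβ forces β ≤ a + √W, so β² ≤ W + a√W + a² is below the
overestimated variance inside the threshold, and κ times the threshold exceeds that deviation. -/
theorem lt_or_lt_of_normThreshold_lt {a κ β W Y : ℝ} (ha : 0 ≤ a) (hκ : 0 < κ) (hκ1 : κ ≤ 1)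
    (hβ : 0 ≤ β) (hW : 0 ≤ W) (h : κ * normThreshold (a ^ 2 / 2) W < |Y|) :
    κ * a * β + (κ * a) ^ 2 / 6 < |Y| ∨ W < β ^ 2 - κ * a * β := by
  by_contra! hcon
  obtain ⟨h1, h2⟩ := hcon
  have hs : √(2 * (a ^ 2 / 2) * W) = a * √W := by
    rw [show 2 * (a ^ 2 / 2) * W = a ^ 2 * W by ring, Real.sqrt_mul (sq_nonneg a),
      Real.sqrt_sq ha]
  set w := √W with hw
  have hw0 : 0 ≤ w := Real.sqrt_nonneg _
  have hww : w ^ 2 = W := Real.sq_sqrt hW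
  have hka : κ * a ≤ a := by nlinarith
  have hβ1 : β ^ 2 ≤ W + a * β := by nlinarith
  have hβ2 : β ≤ a + w := by
    by_contra! hlt
    nlinarith
  have hβ3 : β ^ 2 ≤ W + a * w + 3 * (a ^ 2 / 2) := by nlinarith
  have h4 : a * β ≤ √(2 * (a ^ 2 / 2) * (W + √(2 * (a ^ 2 / 2) * W) + 3 * (a ^ 2 / 2))) := by
    apply Real.le_sqrt_of_sq_le
    rw [hs, mul_pow]
    nlinarith [sq_nonneg a, mul_le_mul_of_nonneg_left hβ3 (sq_nonneg a)]
  have h5 : κ * a * β + (κ * a) ^ 2 / 6 ≤ κ * normThreshold (a ^ 2 / 2) W := by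
    unfold normThreshold
    have h6 : (κ * a) ^ 2 / 6 ≤ κ * (a ^ 2 / 2 / 3) := by
      have : κ ^ 2 ≤ κ := by nlinarith
      rw [mul_pow]; nlinarith [mul_le_mul_of_nonneg_right this (sq_nonneg a)]
    nlinarith
  linarith

theorem sq_le_eight_mul_exp_half {z : ℝ} (hz : 0 ≤ z) : z ^ 2 ≤ 8 * Real.exp (z / 2) := by
  nlinarith [Real.quadratic_le_exp_of_nonneg (x := z / 2) (by positivity)]

/-- Bounds a second moment on a rare event without Hölder's inequality, hence without loss in the
exponent: below T the event itself is small, above T an exponential moment of z pays exp(-T / 2). -/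
theorem sq_mul_le_of_le_one {z T e : ℝ} (hz : 0 ≤ z) (he : 0 ≤ e) (he1 : e ≤ 1) :
    z ^ 2 * e ≤ T ^ 2 * e + 8 * (Real.exp z * Real.exp (-(T / 2))) := by
  have hp : 0 ≤ 8 * (Real.exp z * Real.exp (-(T / 2))) := by positivity
  rcases le_total z T with h | h
  · have : z ^ 2 * e ≤ T ^ 2 * e := by gcongr
    linarith
  · have h1 := sq_le_eight_mul_exp_half hz
    have h2 : Real.exp (z / 2) ≤ Real.exp z * Real.exp (-(T / 2)) := by
      rw [← Real.exp_add]; gcongr; linarith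
    have h3 : z ^ 2 * e ≤ z ^ 2 := mul_le_of_le_one_right (sq_nonneg _) he1
    have h4 : 0 ≤ T ^ 2 * e := by positivity
    linarith

/-! ### Risk of one normalised coefficient, for small and for large mass. -/

section PointProcess

variable {Ω : Type*} [MeasurableSpace Ω] {P : Measure Ω} [IsProbabilityMeasure P]
  {N : Ω → Set ℝ} {μ : Measure ℝ} [IsFiniteMeasure μ]

theorem finite_range_indicator (A : Set ℝ) :
    (Set.range (A.indicator (1 : ℝ → ℝ))).Finite := by
  refine (Set.toFinite {0, 1}).subset ?_
  rintro _ ⟨x, rfl⟩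
  by_cases hx : x ∈ A <;> simp [hx]

theorem abs_integral_le_measureReal {y : ℝ → ℝ} (hy : Measurable y) (hs : (Set.range y).Finite)
    (hy1 : ∀ x, |y x| ≤ 1) : |∫ x, y x ∂μ| ≤ μ.real {x | y x ≠ 0} := by
  have hm : MeasurableSet {x | y x ≠ 0} := hy (measurableSet_singleton 0).compl
  have hi : Integrable (fun x => |y x|) μ :=
    (integrable_comp_of_finite_range hy hs).abs
  calc |∫ x, y x ∂μ| ≤ ∫ x, |y x| ∂μ := abs_integral_le_integral_abs
    _ ≤ ∫ x, {x | y x ≠ 0}.indicator (1 : ℝ → ℝ) x ∂μ := by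
        refine integral_mono hi ((integrable_const (1 : ℝ)).indicator hm) fun x => ?_
        by_cases hx : y x = 0
        · simp [hx]
        · simp [hx, hy1 x]
    _ = _ := integral_indicator_one hm

theorem integral_sq_le_measureReal {y : ℝ → ℝ} (hy : Measurable y) (hs : (Set.range y).Finite)
    (hy1 : ∀ x, |y x| ≤ 1) : ∫ x, y x ^ 2 ∂μ ≤ μ.real {x | y x ≠ 0} := by
  have h := abs_integral_le_measureReal (μ := μ) (y := fun x => y x ^ 2) (hy.pow_const 2)
    (finite_range_comp hs (fun v => v ^ 2))
    (fun x => by rw [abs_pow]; exact pow_le_one₀ (abs_nonneg _) (hy1 x))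
  refine (le_abs_self _).trans (h.trans (le_of_eq ?_))
  congr 1
  ext x
  simp

theorem mul_measureReal_le_integral_sq {y : ℝ → ℝ} (hy : Measurable y)
    (hs : (Set.range y).Finite) {c₀ : ℝ} (hc₀ : 0 ≤ c₀) (hyc : ∀ x, y x ≠ 0 → c₀ ≤ |y x|) :
    c₀ ^ 2 * μ.real {x | y x ≠ 0} ≤ ∫ x, y x ^ 2 ∂μ := by
  have hm : MeasurableSet {x | y x ≠ 0} := hy (measurableSet_singleton 0).compl
  have i2 : Integrable (fun x => y x ^ 2) μ :=
    integrable_comp_of_finite_range (hy.pow_const 2) (finite_range_comp hs (fun v => v ^ 2))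
  rw [← integral_indicator_one hm, ← integral_const_mul]
  refine integral_mono (((integrable_const (1 : ℝ)).indicator hm).const_mul _) i2 fun x => ?_
  by_cases hx : y x = 0
  · simp [hx]
  · simp only [Set.indicator, Set.mem_ofPred_eq, hx, not_false_eq_true, ne_eq, if_true,
      Pi.one_apply, mul_one]
    rw [← sq_abs (y x)]
    have := hyc x hx
    gcongr

open Classical in
-- With K the number of points in the support of y, |B| ≤ K, so a kept coefficient has K ≥ m ≥ 1 ≥ p
-- ≥ |b| and error at most 4K².
theorem lintegral_error_le_of_small (h : IsPoissonProcess P N μ) {y : ℝ → ℝ}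
    (hy : Measurable y) (hs : (Set.range y).Finite) (hy1 : ∀ x, |y x| ≤ 1) {t m : ℝ} {H : Ω → ℝ}
    (ht : 2 ≤ t) (hm : 1 ≤ m) (hp : μ.real {x | y x ≠ 0} * Real.exp t ≤ 1) (hH : ∀ ω, m ≤ H ω) :
    ∫⁻ ω, ENNReal.ofReal (((if H ω ≤ |stochInt N y ω| then stochInt N y ω else 0)
      - ∫ x, y x ∂μ) ^ 2) ∂P ≤
    ENNReal.ofReal ((∫ x, y x ∂μ) ^ 2
      + 32 * (μ.real {x | y x ≠ 0} * Real.exp (t - (t - 1) * m))) := by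
  set A := {x | y x ≠ 0} with hAdef
  have hA : MeasurableSet A := hy (measurableSet_singleton 0).compl
  have hb := abs_integral_le_measureReal (μ := μ) hy hs hy1
  rw [← hAdef] at hb
  set p := μ.real A
  set b := ∫ x, y x ∂μ
  have hp0 : 0 ≤ p := measureReal_nonneg
  set K : Ω → ℝ := stochInt N (A.indicator 1) with hK
  have hmK : Measurable (A.indicator (1 : ℝ → ℝ)) := measurable_one.indicator hA
  have hiK := integrable_exp_stochInt h hmK (finite_range_indicator A) t
  have hK0 : ∀ ω, 0 ≤ K ω := stochInt_nonneg fun x => Set.indicator_nonneg (by simp) x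
  have hp1 : p ≤ 1 := by
    have : 1 ≤ Real.exp t := Real.one_le_exp (by linarith)
    nlinarith
  -- Subtracting 1 is harmless where K ≥ 1, since there exp(tK) ≤ 2 (exp(tK) - 1). It makes the
  -- expectation exp(p (exp t - 1)) - 1 ≤ 2 p exp t proportional to p.
  refine lintegral_ofReal_le_of_le
    (Z := fun ω => b ^ 2 + 16 * Real.exp (-(t - 1) * m) * (Real.exp (t * K ω) - 1))
    ?_ ?_ ?_ ?_
  · exact (integrable_const _).add ((hiK.sub (integrable_const _)).const_mul _)
  · refine ae_of_all _ fun ω => ?_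
    have : 1 ≤ Real.exp (t * K ω) := Real.one_le_exp (mul_nonneg (by linarith) (hK0 ω))
    have h0 : 0 ≤ Real.exp (t * K ω) - 1 := by linarith
    simp only [Pi.zero_apply]
    positivity
  · filter_upwards [ae_finite_of_isPoissonProcess h] with ω hω
    have hKexp : 1 ≤ Real.exp (t * K ω) := Real.one_le_exp (mul_nonneg (by linarith) (hK0 ω))
    have h0 : 0 ≤ Real.exp (t * K ω) - 1 := by linarith
    split_ifs with hk
    · have hBK : |stochInt N y ω| ≤ K ω := by
        refine abs_stochInt_le (fun x => ?_) hω
        by_cases hx : y x = 0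
        · simp [hx, A]
        · simp [hx, hy1 x, A]
      have hmK' : m ≤ K ω := (hH ω).trans (hk.trans hBK)
      have h1 : (stochInt N y ω - b) ^ 2 ≤ (2 * K ω) ^ 2 := by
        rw [← sq_abs]
        gcongr
        have := abs_sub (stochInt N y ω) b
        linarith
      have h2 : K ω ^ 2 ≤ 2 * Real.exp (K ω) := by
        nlinarith [Real.quadratic_le_exp_of_nonneg (hK0 ω), hK0 ω]
      have h3 : Real.exp (K ω) ≤ Real.exp (-(t - 1) * m) * Real.exp (t * K ω) := by
        rw [← Real.exp_add]
        gcongr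
        nlinarith
      have h4 : Real.exp (t * K ω) ≤ 2 * (Real.exp (t * K ω) - 1) := by
        nlinarith [Real.add_one_le_exp (t * K ω)]
      have h5 : Real.exp (-(t - 1) * m) * Real.exp (t * K ω) ≤
          Real.exp (-(t - 1) * m) * (2 * (Real.exp (t * K ω) - 1)) := by gcongr
      nlinarith [sq_nonneg b]
    · have : 0 ≤ 16 * Real.exp (-(t - 1) * m) * (Real.exp (t * K ω) - 1) := by positivity
      nlinarith
  · have hi1 : Integrable (fun ω => Real.exp (t * K ω) - 1) P := hiK.sub (integrable_const _)
    rw [integral_add (integrable_const _) (hi1.const_mul _), integral_const_mul, integral_sub hiK (integrable_const _), integral_exp_stochInt h hmK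
        (finite_range_indicator A)]
    simp only [integral_const, probReal_univ, one_smul]
    have h1 : ∫ x, (Real.exp (t * A.indicator (1 : ℝ → ℝ) x) - 1) ∂μ = p * (Real.exp t - 1) := by
      have : ∀ x, Real.exp (t * A.indicator (1 : ℝ → ℝ) x) - 1 =
          A.indicator (fun _ => Real.exp t - 1) x := by
        intro x; by_cases hx : x ∈ A <;> simp [hx]
      simp_rw [this]
      rw [integral_indicator_const _ hA, smul_eq_mul]
    rw [h1]
    have h2 : Real.exp (p * (Real.exp t - 1)) - 1 ≤ 2 * (p * Real.exp t) := by
      have h3 : Real.exp (p * (Real.exp t - 1)) ≤ Real.exp (p * Real.exp t) := by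
        gcongr; linarith
      have h4 : 0 ≤ p * Real.exp t := by positivity
      have h5 := exp_le_one_add_add_sq_div (a := 1) (t := p * Real.exp t) (by norm_num)
        (by rwa [abs_of_nonneg h4])
      norm_num at h5
      nlinarith
    have h6 : Real.exp (t - (t - 1) * m) = Real.exp t * Real.exp (-(t - 1) * m) := by
      rw [← Real.exp_add]; congr 1; ring
    rw [h6]
    have h7 : Real.exp (-(t - 1) * m) * (Real.exp (p * (Real.exp t - 1)) - 1) ≤
      Real.exp (-(t - 1) * m) * (2 * (p * Real.exp t)) := by gcongr
    linarith

open Classical in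
-- G is a majorant of min(b², h²) left free: it will be either b² or a random bound for h². The
-- second term is the cost of a deviation larger than κ h.
theorem lintegral_error_le_of_large (h : IsPoissonProcess P N μ) {y : ℝ → ℝ}
    (hy : Measurable y) (hs : (Set.range y).Finite) (hy1 : ∀ x, |y x| ≤ 1) {a κ q D : ℝ}
    {G : Ω → ℝ} (ha : 0 < a) (hκ : 0 < κ) (hκ1 : κ < 1) (hv : 0 < ∫ x, y x ^ 2 ∂μ) (hq : 1 ≤ q)
    (hvq : ∫ x, y x ^ 2 ∂μ ≤ q) (hG : Integrable G P) (hGD : ∫ ω, G ω ∂P ≤ D)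
    (hGle : ∀ ω, min ((∫ x, y x ∂μ) ^ 2)
      (normThreshold (a ^ 2 / 2) (stochInt N (fun x => y x ^ 2) ω) ^ 2) ≤ G ω) :
    ∫⁻ ω, ENNReal.ofReal (((if normThreshold (a ^ 2 / 2) (stochInt N (fun x => y x ^ 2) ω)
      ≤ |stochInt N y ω| then stochInt N y ω else 0) - ∫ x, y x ∂μ) ^ 2) ∂P ≤
    ENNReal.ofReal (4 / (1 - κ) ^ 2 * D + 4 / κ ^ 2 * (q *
      ((12 * (κ ^ 2 * (a ^ 2 / 2)) ^ 2 + 48) * Real.exp (-(κ ^ 2 * (a ^ 2 / 2)))))) := by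
  set b := ∫ x, y x ∂μ with hb
  set v := ∫ x, y x ^ 2 ∂μ with hvdef
  set B := stochInt N y with hB
  set W := stochInt N (fun x => y x ^ 2) with hW
  set β := √v with hβdef
  have hβ : 0 < β := Real.sqrt_pos.2 hv
  have hβv : v = β ^ 2 := (Real.sq_sqrt hv.le).symm
  set α := κ * a with hαdef
  have hα : 0 < α := by positivity
  have hW0 : ∀ ω, 0 ≤ W ω := stochInt_nonneg fun x => sq_nonneg _
  have hα2 : κ ^ 2 * (a ^ 2 / 2) = α ^ 2 / 2 := by rw [hαdef]; ring
  rw [hα2]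
  -- At this scale s² v ≤ 1 and s ≤ 1, so the centred exponential moments of ±sB are at most e^{3/4}
  -- ≤ 3.
  set s := 1 / √q with hsdef
  have hq0 : 0 < q := by linarith
  have hsq1 : 1 ≤ √q := by rw [Real.one_le_sqrt]; exact hq
  have hs0 : 0 < s := by positivity
  have hs1 : s ≤ 1 := by rw [hsdef, div_le_one (by positivity)]; exact hsq1
  have hs2 : s ^ 2 = 1 / q := by rw [hsdef, div_pow, Real.sq_sqrt hq0.le, one_pow]
  set r := 3 * α / (α + 3 * β) with hr
  set x₀ := α * β + α ^ 2 / 6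
  -- E₁ and E₂ dominate the indicators of the two tails of B and E₃ that of the lower tail of W; E₄
  -- + E₅ dominates exp(s |B - b|).
  set E₁ : Ω → ℝ := fun ω => Real.exp (r * (1 * (B ω - b) - x₀))
  set E₂ : Ω → ℝ := fun ω => Real.exp (r * ((-1) * (B ω - b) - x₀))
  set E₃ : Ω → ℝ := fun ω => Real.exp (-(α / β) * (W ω - β ^ 2 + α * β))
  set E₄ : Ω → ℝ := fun ω => Real.exp (s * B ω) * Real.exp (-(s * b))
  set E₅ : Ω → ℝ := fun ω => Real.exp (-s * B ω) * Real.exp (s * b)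
  have hr0 : 0 < r := by positivity
  have hm2 : Measurable fun x => y x ^ 2 := hy.pow_const 2
  have hf2 := finite_range_comp hs (fun v => v ^ 2)
  have i1 : Integrable E₁ P := by
    have := (integrable_exp_stochInt h hy hs r).mul_const (Real.exp (r * (-b - x₀)))
    refine this.congr (ae_of_all _ fun ω => ?_)
    simp only [E₁]
    rw [← Real.exp_add]; congr 1; ring
  have i2 : Integrable E₂ P := by
    have := (integrable_exp_stochInt h hy hs (-r)).mul_const (Real.exp (r * (b - x₀)))
    refine this.congr (ae_of_all _ fun ω => ?_)
    simp only [E₂]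
    rw [← Real.exp_add]; congr 1; ring
  have i3 : Integrable E₃ P := by
    have := (integrable_exp_stochInt h hm2 hf2 (-(α / β))).mul_const
      (Real.exp (-(α / β) * (- β ^ 2 + α * β)))
    refine this.congr (ae_of_all _ fun ω => ?_)
    simp only [E₃]
    rw [← Real.exp_add]; congr 1; ring
  have i4 : Integrable E₄ P := (integrable_exp_stochInt h hy hs s).mul_const _
  have i5 : Integrable E₅ P := (integrable_exp_stochInt h hy hs (-s)).mul_const _
  have b1 : ∫ ω, E₁ ω ∂P ≤ Real.exp (-(α ^ 2 / 2)) :=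
    bernstein_exp h hy hs hy1 hα hβ hβv (by simp)
  have b2 : ∫ ω, E₂ ω ∂P ≤ Real.exp (-(α ^ 2 / 2)) :=
    bernstein_exp h hy hs hy1 hα hβ hβv (by simp)
  have b3 : ∫ ω, E₃ ω ∂P ≤ Real.exp (-(α ^ 2 / 2)) :=
    integral_exp_neg_sq_le h hy hs hy1 hα hβ hβv
  have hexp3 : ∀ σ : ℝ, |σ| = s →
      (∫ ω, Real.exp (σ * B ω) ∂P) * Real.exp (-(σ * b)) ≤ 3 := by
    intro σ hσ
    have h1 := integral_exp_stochInt_le h hy hs hy1 (t := σ) (by rw [hσ]; linarith)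
    rw [← hb, ← hvdef, hσ, ← sq_abs σ, hσ, hs2] at h1
    have h2 : 1 / q * v / (2 * (1 - s / 3)) ≤ 3 / 4 := by
      have h3 : 1 / q * v ≤ 1 := by rw [one_div, ← div_eq_inv_mul, div_le_one hq0]; exact hvq
      rw [div_le_iff₀ (by linarith)]
      linarith
    calc _ ≤ Real.exp (σ * b + 1 / q * v / (2 * (1 - s / 3))) * Real.exp (-(σ * b)) := by gcongr
      _ = Real.exp (1 / q * v / (2 * (1 - s / 3))) := by rw [← Real.exp_add]; congr 1; ring
      _ ≤ Real.exp 1 := by gcongr; linarith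
      _ ≤ 3 := by linarith [Real.exp_one_lt_d9]
  have b4 : ∫ ω, E₄ ω ∂P ≤ 3 := by
    simp only [E₄]
    rw [integral_mul_const]
    exact hexp3 s (abs_of_pos hs0)
  have b5 : ∫ ω, E₅ ω ∂P ≤ 3 := by
    simp only [E₅]
    rw [integral_mul_const]
    have := hexp3 (-s) (by rw [abs_neg, abs_of_pos hs0])
    rwa [neg_mul, neg_neg] at this
  set e := Real.exp (-(α ^ 2 / 2)) with he
  have he0 : 0 < e := Real.exp_pos _
  set A₁ := 4 / (1 - κ) ^ 2 with hA₁
  set A₂ := 4 / κ ^ 2 with hA₂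
  have hA₁0 : 0 ≤ A₁ := by positivity
  have hA₂0 : 0 ≤ A₂ := by positivity
  have hGnn : ∀ ω, 0 ≤ G ω := fun ω => le_trans (le_min (sq_nonneg _) (sq_nonneg _)) (hGle ω)
  have j1 : Integrable (fun ω => α ^ 4 * (E₁ ω + E₂ ω + E₃ ω) + 8 * e * (E₄ ω + E₅ ω)) P :=
    (((i1.add i2).add i3).const_mul _).add ((i4.add i5).const_mul _)
  refine lintegral_ofReal_le_of_le
    (Z := fun ω => A₁ * G ω + A₂ * q *
      (α ^ 4 * (E₁ ω + E₂ ω + E₃ ω) + 8 * e * (E₄ ω + E₅ ω))) ?_ ?_ ?_ ?_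
  · exact (hG.const_mul _).add (j1.const_mul _)
  · refine ae_of_all _ fun ω => ?_
    have := hGnn ω
    have h1 : 0 ≤ E₁ ω + E₂ ω + E₃ ω := by positivity
    have h2 : 0 ≤ E₄ ω + E₅ ω := by positivity
    simp only [Pi.zero_apply]
    positivity
  · refine ae_of_all _ fun ω => ?_
    have hh0 : 0 ≤ normThreshold (a ^ 2 / 2) (W ω) := le_trans (by positivity) normThreshold_ge
    refine (thresholded_error_le (B := B ω) (b := b) hκ hκ1 hh0).trans ?_
    set ind : ℝ := if κ * normThreshold (a ^ 2 / 2) (W ω) < |B ω - b| then 1 else 0 with hind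
    have hind0 : 0 ≤ ind := by rw [hind]; split_ifs <;> norm_num
    have hind1 : ind ≤ 1 := by rw [hind]; split_ifs <;> norm_num
    have hindE : ind ≤ E₁ ω + E₂ ω + E₃ ω := by
      have p1 : 0 < E₁ ω := Real.exp_pos _
      have p2 : 0 < E₂ ω := Real.exp_pos _
      have p3 : 0 < E₃ ω := Real.exp_pos _
      by_cases hbad : κ * normThreshold (a ^ 2 / 2) (W ω) < |B ω - b|
      · simp only [hind, hbad, if_true]
        rcases lt_or_lt_of_normThreshold_lt ha.le hκ hκ1.le hβ.le (hW0 ω) hbad with h1 | h1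
        · rcases le_total 0 (B ω - b) with h2 | h2
          · rw [abs_of_nonneg h2] at h1
            have : 1 ≤ E₁ ω := Real.one_le_exp (mul_nonneg hr0.le (by simp only [x₀]; linarith))
            linarith
          · rw [abs_of_nonpos h2] at h1
            have : 1 ≤ E₂ ω := Real.one_le_exp (mul_nonneg hr0.le (by simp only [x₀]; linarith))
            linarith
        · have : 1 ≤ E₃ ω := by
            refine Real.one_le_exp ?_
            rw [neg_mul, ← mul_neg]
            exact mul_nonneg (by positivity) (by linarith)
          linarith
      · simp only [hind, hbad, if_false]
        positivity
    have hz : (B ω - b) ^ 2 * ind = q * ((s * |B ω - b|) ^ 2 * ind) := by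
      rw [mul_pow, hs2, sq_abs]; field_simp
    have hz2 := sq_mul_le_of_le_one (z := s * |B ω - b|) (T := α ^ 2) (e := ind) (by positivity)
      hind0 hind1
    have hz3 : Real.exp (s * |B ω - b|) ≤ E₄ ω + E₅ ω := by
      have p4 : 0 < E₄ ω := by positivity
      have p5 : 0 < E₅ ω := by positivity
      rcases le_total 0 (B ω - b) with h2 | h2
      · rw [abs_of_nonneg h2]
        have : Real.exp (s * (B ω - b)) = E₄ ω := by
          simp only [E₄]; rw [← Real.exp_add]; congr 1; ring
        linarith
      · rw [abs_of_nonpos h2]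
        have : Real.exp (s * -(B ω - b)) = E₅ ω := by
          simp only [E₅]; rw [← Real.exp_add]; congr 1; ring
        linarith
    rw [hz]
    have h4 : (s * |B ω - b|) ^ 2 * ind ≤
        α ^ 4 * (E₁ ω + E₂ ω + E₃ ω) + 8 * e * (E₄ ω + E₅ ω) := by
      refine hz2.trans ?_
      have h5 : (α ^ 2) ^ 2 * ind ≤ α ^ 4 * (E₁ ω + E₂ ω + E₃ ω) := by
        rw [← pow_mul]; gcongr
      have h6 : Real.exp (s * |B ω - b|) * e ≤ (E₄ ω + E₅ ω) * e := by gcongr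
      linarith
    have h7 := mul_le_mul_of_nonneg_left (hGle ω) hA₁0
    have h8 : A₂ * (q * ((s * |B ω - b|) ^ 2 * ind)) ≤
        A₂ * q * (α ^ 4 * (E₁ ω + E₂ ω + E₃ ω) + 8 * e * (E₄ ω + E₅ ω)) := by
      rw [mul_assoc]; gcongr
    linarith
  · have k2 : Integrable (fun ω => E₁ ω + E₂ ω) P := i1.add i2
    have k3 : Integrable (fun ω => E₁ ω + E₂ ω + E₃ ω) P := k2.add i3
    have k5 : Integrable (fun ω => E₄ ω + E₅ ω) P := i4.add i5
    rw [integral_add (hG.const_mul _) (j1.const_mul _), integral_const_mul, integral_const_mul,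
      integral_add (k3.const_mul _) (k5.const_mul _),
      integral_const_mul, integral_const_mul, integral_add k2 i3, integral_add i1 i2,
      integral_add i4 i5]
    have h1 : A₁ * ∫ ω, G ω ∂P ≤ A₁ * D := by gcongr
    have h2 : α ^ 4 * (∫ ω, E₁ ω ∂P + ∫ ω, E₂ ω ∂P + ∫ ω, E₃ ω ∂P) +
        8 * e * (∫ ω, E₄ ω ∂P + ∫ ω, E₅ ω ∂P) ≤ (12 * (α ^ 2 / 2) ^ 2 + 48) * e := by
      have h3 : α ^ 4 * (∫ ω, E₁ ω ∂P + ∫ ω, E₂ ω ∂P + ∫ ω, E₃ ω ∂P) ≤ α ^ 4 * (3 * e) := by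
        gcongr; linarith
      have h4 : 8 * e * (∫ ω, E₄ ω ∂P + ∫ ω, E₅ ω ∂P) ≤ 8 * e * 6 := by
        gcongr; linarith
      nlinarith
    have h5 := mul_le_mul_of_nonneg_left h2 (mul_nonneg hA₂0 hq0.le)
    linarith

end PointProcess

/-- When p ≤ l, b² ≤ p² ≤ p l ≤ v l / c₀²: estimating the coefficient by 0 is already optimal up to
a constant. -/
theorem sq_le_inv_sq_mul_min {b p v l c₀ : ℝ} (hc₀ : 0 < c₀) (hc₀1 : c₀ ≤ 1) (hp : 0 ≤ p)
    (hb : |b| ≤ p) (hv : c₀ ^ 2 * p ≤ v) (hpl : p ≤ l) :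
    b ^ 2 ≤ 1 / c₀ ^ 2 * min (b ^ 2) (v * l) := by
  have h1 : 1 ≤ 1 / c₀ ^ 2 := by
    rw [le_div_iff₀ (by positivity), one_mul]; exact pow_le_one₀ hc₀.le hc₀1
  rcases min_choice (b ^ 2) (v * l) with hc | hc <;> rw [hc]
  · nlinarith [sq_nonneg b]
  · rw [one_div, ← div_eq_inv_mul, le_div_iff₀ (by positivity)]
    have h2 : b ^ 2 ≤ p * p := by rw [← sq_abs]; nlinarith [abs_nonneg b]
    calc b ^ 2 * c₀ ^ 2 ≤ p * p * c₀ ^ 2 := by gcongr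
      _ = (c₀ ^ 2 * p) * p := by ring
      _ ≤ v * l := by
        have : 0 ≤ c₀ ^ 2 * p := by positivity
        gcongr
        linarith

set_option maxHeartbeats 1000000 in
open Classical in
/-- The risk of the thresholded estimator of one coefficient, in normalised form. -/
theorem exists_coefficient_risk_bound {c γ c₀ : ℝ} (hc : 1 ≤ c) (hγ : c < γ) (hc₀ : 0 < c₀)
    (hc₀1 : c₀ ≤ 1) : ∃ C : ℝ, 0 < C ∧ ∃ l₀ : ℝ, 0 < l₀ ∧ ∀ l : ℝ, l₀ ≤ l →
      ∀ {Ω : Type*} [MeasurableSpace Ω] {P : Measure Ω} [IsProbabilityMeasure P]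
        {N : Ω → Set ℝ} {μ : Measure ℝ} [IsFiniteMeasure μ], IsPoissonProcess P N μ →
      ∀ {y : ℝ → ℝ}, Measurable y → (Set.range y).Finite → (∀ x, |y x| ≤ 1) →
        (∀ x, y x ≠ 0 → c₀ ≤ |y x|) →
      ∫⁻ ω, ENNReal.ofReal (((if normThreshold (γ * l) (stochInt N (fun x => y x ^ 2) ω)
        ≤ |stochInt N y ω| then stochInt N y ω else 0) - ∫ x, y x ∂μ) ^ 2) ∂P ≤
      ENNReal.ofReal (C * (min ((∫ x, y x ∂μ) ^ 2) ((∫ x, y x ^ 2 ∂μ) * l)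
        + μ.real {x | y x ≠ 0} * Real.exp (-(c + (γ - c) / 4) * l))) := by
  -- The gap γ - c is cut in four: one part makes κ < 1 in κ² γ = c + 3d, one absorbs the factor l²,
  -- one trades 1 for p exp(d l), and one stays in the final exponent c + d.
  set d := (γ - c) / 4 with hd
  have hd0 : 0 < d := by rw [hd]; linarith
  have hγ0 : 0 < γ := by linarith
  set κ := √((c + 3 * d) / γ) with hκdef
  have hκ2 : κ ^ 2 = (c + 3 * d) / γ := Real.sq_sqrt (by positivity)
  have hκ : 0 < κ := Real.sqrt_pos.2 (by positivity)
  have hκ1 : κ < 1 := by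
    rw [hκdef, Real.sqrt_lt' one_pos, one_pow, div_lt_one hγ0, hd]; linarith
  set A₁ := 4 / (1 - κ) ^ 2 with hA₁
  set A₂ := 4 / κ ^ 2 with hA₂
  have hA₁0 : 0 ≤ A₁ := by positivity
  have hA₂0 : 0 ≤ A₂ := by positivity
  set M := 24 * (c + 3 * d) ^ 2 / d ^ 2 + 48 with hM
  set R := 1 / c₀ ^ 2 with hR
  have hR0 : 0 < R := by positivity
  set R' := R + 16 * γ + 17 * γ ^ 2 * R + 1 with hR'
  have hR'0 : 0 ≤ R' := by positivity
  refine ⟨A₁ * R' + R + A₂ * M + 32, by positivity,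
    1 + 2 / d + 3 / γ + 6 * (c + 2 * d) / (d * γ), by positivity, ?_⟩
  intro l hl Ω _ P _ N μ _ h y hy hs hy1 hyc
  have hl1 : 1 ≤ l := by
    have h1 : 0 ≤ 2 / d + 3 / γ + 6 * (c + 2 * d) / (d * γ) := by positivity
    linarith
  have hdl : 2 ≤ d * l := by
    have h1 : 0 ≤ 1 + 3 / γ + 6 * (c + 2 * d) / (d * γ) := by positivity
    have h2 : 2 / d ≤ l := by linarith
    rw [div_le_iff₀ hd0] at h2; linarith
  have hγl : 1 ≤ γ * l / 3 := by
    have h1 : 0 ≤ 1 + 2 / d + 6 * (c + 2 * d) / (d * γ) := by positivity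
    have h2 : 3 / γ ≤ l := by linarith
    rw [div_le_iff₀ hγ0] at h2; linarith
  have hdγl : 6 * (c + 2 * d) ≤ d * γ * l := by
    have h1 : 0 ≤ 1 + 2 / d + 3 / γ := by positivity
    have h2 : 6 * (c + 2 * d) / (d * γ) ≤ l := by linarith
    rw [div_le_iff₀ (by positivity)] at h2; linarith
  have hb := abs_integral_le_measureReal (μ := μ) hy hs hy1
  have hvp := integral_sq_le_measureReal (μ := μ) hy hs hy1
  have hpv := mul_measureReal_le_integral_sq (μ := μ) hy hs hc₀.le hyc
  have hp0 : 0 ≤ μ.real {x | y x ≠ 0} := measureReal_nonneg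
  set p := μ.real {x | y x ≠ 0} with hp
  set b := ∫ x, y x ∂μ with hbdef
  set v := ∫ x, y x ^ 2 ∂μ with hvdef
  have hv0 : 0 ≤ v := le_trans (by positivity) hpv
  set mn := min (b ^ 2) (v * l) with hmn
  have hmn0 : 0 ≤ mn := le_min (sq_nonneg _) (by positivity)
  set ex := Real.exp (-(c + d) * l) with hex
  have hex0 : 0 < ex := Real.exp_pos _
  rcases le_or_gt (p * Real.exp (d * l)) 1 with hsm | hlg
  · refine (lintegral_error_le_of_small h hy hs hy1 hdl hγl hsm
      (fun ω => normThreshold_ge)).trans (ENNReal.ofReal_le_ofReal ?_)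
    have hpl : p ≤ l := by
      have : 1 ≤ Real.exp (d * l) := Real.one_le_exp (by linarith)
      nlinarith
    have h1 := sq_le_inv_sq_mul_min hc₀ hc₀1 hp0 hb hpv hpl
    -- The gain is quadratic in l, so it exceeds (c + 2d) l once l ≥ 6 (c + 2d) / (d γ).
    have h2 : Real.exp (d * l - (d * l - 1) * (γ * l / 3)) ≤ ex := by
      rw [hex]
      gcongr
      have h3 : d * l / 2 * (γ * l / 3) ≤ (d * l - 1) * (γ * l / 3) := by gcongr; linarith
      have h4 : 6 * (c + 2 * d) * l ≤ d * γ * l * l := by gcongr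
      linarith
    have h5 : p * Real.exp (d * l - (d * l - 1) * (γ * l / 3)) ≤ p * ex := by gcongr
    have h6 : 0 ≤ p * ex := by positivity
    have h7 : 0 ≤ A₁ * R' + A₂ * M := by positivity
    have h8 : 0 ≤ (A₁ * R' + A₂ * M) * (mn + p * ex) := by positivity
    have h9 : 0 ≤ R * (p * ex) := by positivity
    rw [← hmn, ← hR] at h1
    linarith
  · have hppos : 0 < p := by
      by_contra! hcon
      have : p = 0 := le_antisymm hcon hp0
      rw [this, zero_mul] at hlg
      linarith
    have hvpos : 0 < v := lt_of_lt_of_le (by positivity) hpv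
    set a := √(2 * (γ * l)) with ha
    have ha0 : 0 < a := Real.sqrt_pos.2 (by positivity)
    have ha2 : a ^ 2 / 2 = γ * l := by rw [ha, Real.sq_sqrt (by positivity)]; ring
    have hu1 : κ ^ 2 * (a ^ 2 / 2) = (c + 3 * d) * l := by rw [hκ2, ha2]; field_simp
    set q := max p 1 with hq
    have hqp : q ≤ p * Real.exp (d * l) := by
      refine max_le ?_ hlg.le
      have : 1 ≤ Real.exp (d * l) := Real.one_le_exp (by linarith)
      nlinarith
    have hrem : q * ((12 * (κ ^ 2 * (a ^ 2 / 2)) ^ 2 + 48) * Real.exp (-(κ ^ 2 * (a ^ 2 / 2)))) ≤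
        M * (p * ex) := by
      rw [hu1]
      have h1 : l ^ 2 ≤ 2 / d ^ 2 * Real.exp (d * l) := by
        have := Real.quadratic_le_exp_of_nonneg (x := d * l) (by positivity)
        have h0 : 0 ≤ d * l := by positivity
        rw [div_mul_eq_mul_div, le_div_iff₀ (by positivity)]
        linarith
      have h2 : 12 * ((c + 3 * d) * l) ^ 2 + 48 ≤ M * Real.exp (d * l) := by
        have h3 : 1 ≤ Real.exp (d * l) := Real.one_le_exp (by linarith)
        have h4 : 12 * (c + 3 * d) ^ 2 * l ^ 2 ≤
          12 * (c + 3 * d) ^ 2 * (2 / d ^ 2 * Real.exp (d * l)) := by gcongr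
        have h5 : 12 * (c + 3 * d) ^ 2 * (2 / d ^ 2 * Real.exp (d * l)) =
          24 * (c + 3 * d) ^ 2 / d ^ 2 * Real.exp (d * l) := by ring
        rw [hM, add_mul (_ / _), mul_pow]
        linarith
      calc q * ((12 * ((c + 3 * d) * l) ^ 2 + 48) * Real.exp (-((c + 3 * d) * l)))
          ≤ (p * Real.exp (d * l)) * ((M * Real.exp (d * l)) * Real.exp (-((c + 3 * d) * l))) := by
            gcongr
        _ = M * (p * (Real.exp (d * l) * Real.exp (d * l) * Real.exp (-((c + 3 * d) * l)))) := by
            ring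
        _ = M * (p * ex) := by
            rw [hex, ← Real.exp_add, ← Real.exp_add]; congr 3; ring
    obtain ⟨hWi, hWe⟩ := integrable_stochInt_sq h hy hs hy1
    have key : ∀ D : ℝ, D ≤ R' * mn → ∀ G : Ω → ℝ, Integrable G P → ∫ ω, G ω ∂P ≤ D →
        (∀ ω, min (b ^ 2) (normThreshold (γ * l) (stochInt N (fun x => y x ^ 2) ω) ^ 2) ≤ G ω) →
        ∫⁻ ω, ENNReal.ofReal (((if normThreshold (γ * l) (stochInt N (fun x => y x ^ 2) ω)
        ≤ |stochInt N y ω| then stochInt N y ω else 0) - b) ^ 2) ∂P ≤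
        ENNReal.ofReal ((A₁ * R' + R + A₂ * M + 32) * (mn + p * ex)) := by
      intro D hD G hG hGD hGle
      have := lintegral_error_le_of_large h hy hs hy1 (a := a) (κ := κ) (q := q) (D := D) (G := G)
        ha0 hκ hκ1 hvpos (le_max_right _ _) (hvp.trans (le_max_left _ _)) hG hGD
        (by rw [ha2]; exact hGle)
      rw [ha2] at this
      refine this.trans (ENNReal.ofReal_le_ofReal ?_)
      rw [ha2] at hrem
      have h1 : A₁ * D ≤ A₁ * (R' * mn) := by gcongr
      have h2 := mul_le_mul_of_nonneg_left hrem hA₂0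
      have h6 : 0 ≤ p * ex := by positivity
      have h7 : 0 ≤ (R + 32) * (mn + p * ex) := by positivity
      have h8 : 0 ≤ A₁ * R' * (p * ex) := by positivity
      have h9 : 0 ≤ A₂ * M * mn := by positivity
      rw [← hA₁, ← hA₂]
      linarith
    -- Three cases for E min(b², h²). If p ≤ l or b² ≤ v l, then b² is of the order of the minimum.
    -- Otherwise l ≤ p ≤ v / c₀², which absorbs the l² term of E h² into v l.
    rcases le_total p l with hpl | hpl
    · refine key (b ^ 2) ?_ (fun _ => b ^ 2) (integrable_const _) (by simp) fun ω => min_le_left _ _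
      have h1 := sq_le_inv_sq_mul_min hc₀ hc₀1 hp0 hb hpv hpl
      rw [← hmn, ← hR] at h1
      have h2 : 0 ≤ (16 * γ + 17 * γ ^ 2 * R + 1) * mn := by positivity
      rw [hR']
      linarith
    · rcases le_total (b ^ 2) (v * l) with hbv | hbv
      · refine key (b ^ 2) ?_ (fun _ => b ^ 2) (integrable_const _) (by simp)
          fun ω => min_le_left _ _
        rw [hmn, min_eq_left hbv, hR']
        have h2 : 0 ≤ (R + 16 * γ + 17 * γ ^ 2 * R) * b ^ 2 := by positivity
        linarith
      · refine key (8 * (γ * l) * (2 * v) + 17 * (γ * l) ^ 2) ?_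
          (fun ω => 8 * (γ * l) * stochInt N (fun x => y x ^ 2) ω + 17 * (γ * l) ^ 2)
          ((hWi.const_mul _).add (integrable_const _)) ?_ fun ω => (min_le_right _ _).trans
            (normThreshold_sq_le (by positivity) (stochInt_nonneg (fun x => sq_nonneg _) ω))
        · rw [hmn, min_eq_right hbv, hR']
          have h1 : l ≤ R * v := by
            rw [hR, one_div, ← div_eq_inv_mul, le_div_iff₀ (by positivity)]
            linarith [mul_le_mul_of_nonneg_left hpl (sq_nonneg c₀)]
          have h2 : 17 * (γ * l) ^ 2 ≤ 17 * γ ^ 2 * R * (v * l) := by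
            have : 17 * γ ^ 2 * l * l ≤ 17 * γ ^ 2 * l * (R * v) := by gcongr
            linarith
          have h3 : 0 ≤ (R + 1) * (v * l) := by positivity
          linarith
        · rw [integral_add (hWi.const_mul _) (integrable_const _), integral_const_mul]
          simp only [integral_const, probReal_univ, one_smul]
          gcongr

/-! ### Upper Riesz inequality for a biorthogonal system. -/

section Riesz

variable {H ι : Type*} [NormedAddCommGroup H] [InnerProductSpace ℝ H]

open scoped InnerProductSpace

/-- Signs are chosen greedily, each making its cross term with the previous sum nonpositive. -/
theorem exists_signs_norm_sq_sum_le (x : ι → H) (F : Finset ι) :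
    ∃ ε : ι → ℝ, (∀ i, ε i = 1 ∨ ε i = -1) ∧ ‖∑ i ∈ F, ε i • x i‖ ^ 2 ≤ ∑ i ∈ F, ‖x i‖ ^ 2 := by
  classical
  induction F using Finset.induction_on with
  | empty => exact ⟨fun _ => 1, fun _ => Or.inl rfl, by simp⟩
  | insert i F hi ih =>
    obtain ⟨ε, hε, hle⟩ := ih
    set z := ∑ j ∈ F, ε j • x j with hz
    obtain ⟨σ, hσ, hσle⟩ : ∃ σ : ℝ, (σ = 1 ∨ σ = -1) ∧ σ * ⟪x i, z⟫_ℝ ≤ 0 := by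
      rcases le_total ⟪x i, z⟫_ℝ 0 with h | h
      · exact ⟨1, Or.inl rfl, by linarith⟩
      · exact ⟨-1, Or.inr rfl, by linarith⟩
    refine ⟨Function.update ε i σ, fun j => ?_, ?_⟩
    · by_cases hj : j = i
      · subst hj; simpa using hσ
      · simpa [hj] using hε j
    · rw [Finset.sum_insert hi, Finset.sum_insert hi]
      have h1 : ∑ j ∈ F, Function.update ε i σ j • x j = z := by
        refine Finset.sum_congr rfl fun j hj => ?_
        rw [Function.update_of_ne (by rintro rfl; exact hi hj)]
      rw [h1, Function.update_self, norm_add_sq_real, norm_smul, real_inner_smul_left]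
      have h2 : ‖σ‖ = 1 := by rcases hσ with h | h <;> simp [h]
      rw [h2, one_mul]
      linarith

/-- A biorthogonal system whose synthesis family is bounded, and for which every vector has an
unconditionally convergent expansion, satisfies the upper Riesz inequality. -/
theorem exists_norm_sq_sum_le_of_hasSum [CompleteSpace H] [DecidableEq ι] {a e : ι → H} {D : ℝ}
    (hae : ∀ i j, ⟪a i, e j⟫_ℝ = if i = j then 1 else 0) (hD : ∀ i, ‖e i‖ ≤ D)
    (hsum : ∀ g, HasSum (fun i => ⟪a i, g⟫_ℝ • e i) g) :
    ∃ C : ℝ, 0 < C ∧ ∀ (F : Finset ι) (t : ι → ℝ),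
      ‖∑ i ∈ F, t i • e i‖ ^ 2 ≤ C * ∑ i ∈ F, t i ^ 2 := by
  let T : Finset ι → H →L[ℝ] H := fun F => ∑ i ∈ F, (innerSL ℝ (a i)).smulRight (e i)
  have hT : ∀ F g, T F g = ∑ i ∈ F, ⟪a i, g⟫_ℝ • e i := by
    intro F g; simp [T]
  obtain ⟨K, hK⟩ : ∃ K, ∀ F, ‖T F‖ ≤ K := by
    -- The Cauchy criterion for unconditional convergence bounds the partial sums of each fixed g
    -- over all finite sets.
    refine banach_steinhaus fun g => ?_
    obtain ⟨F₀, hF₀⟩ := (summable_iff_vanishing_norm.1 (hsum g).summable) 1 one_pos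
    refine ⟨1 + ∑ i ∈ F₀, ‖⟪a i, g⟫_ℝ • e i‖, fun F => ?_⟩
    rw [hT, ← Finset.sum_inter_add_sum_sdiff F F₀, add_comm]
    refine (norm_add_le _ _).trans (add_le_add ?_ ?_)
    · exact (hF₀ _ Finset.sdiff_disjoint).le
    · exact (norm_sum_le _ _).trans (Finset.sum_le_sum_of_subset_of_nonneg
        Finset.inter_subset_right fun _ _ _ => norm_nonneg _)
  have hK0 : 0 ≤ K := (norm_nonneg _).trans (hK ∅)
  refine ⟨(2 * K * D) ^ 2 + 1, by positivity, fun F t => ?_⟩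
  obtain ⟨ε, hε, hle⟩ := exists_signs_norm_sq_sum_le (fun i => t i • e i) F
  set g := ∑ i ∈ F, ε i • t i • e i with hg
  have hcoef : ∀ i ∈ F, ⟪a i, g⟫_ℝ = ε i * t i := by
    intro i hi
    rw [hg, inner_sum, Finset.sum_eq_single i]
    · rw [real_inner_smul_right, real_inner_smul_right, hae]; simp
    · intro j _ hji
      rw [real_inner_smul_right, real_inner_smul_right, hae, if_neg (Ne.symm hji)]; simp
    · exact fun h => absurd hi h
  -- The signed sum g has small norm, and two partial-sum operators, over the positive and the
  -- negative signs, recover the unsigned sum from it.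
  have hsplit : ∑ i ∈ F, t i • e i =
      T (F.filter fun i => ε i = 1) g - T (F.filter fun i => ¬ ε i = 1) g := by
    rw [hT, hT, ← Finset.sum_filter_add_sum_filter_not F (fun i => ε i = 1), sub_eq_add_neg,
      ← Finset.sum_neg_distrib]
    congr 1
    · refine Finset.sum_congr rfl fun i hi => ?_
      rw [Finset.mem_filter] at hi
      rw [hcoef i hi.1, hi.2, one_mul]
    · refine Finset.sum_congr rfl fun i hi => ?_
      rw [Finset.mem_filter] at hi
      rw [hcoef i hi.1, (hε i).resolve_left hi.2, neg_one_mul, neg_smul, neg_neg]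
  have h1 : ‖∑ i ∈ F, t i • e i‖ ≤ 2 * K * ‖g‖ := by
    rw [hsplit]
    refine (norm_sub_le _ _).trans ?_
    have h2 := fun F' => (T F').le_of_opNorm_le (hK F') g
    linarith [h2 (F.filter fun i => ε i = 1), h2 (F.filter fun i => ¬ ε i = 1)]
  have h3 : ‖g‖ ^ 2 ≤ D ^ 2 * ∑ i ∈ F, t i ^ 2 := by
    refine hle.trans ?_
    rw [Finset.mul_sum]
    refine Finset.sum_le_sum fun i _ => ?_
    rw [norm_smul, mul_pow, Real.norm_eq_abs, sq_abs, mul_comm]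
    have := hD i
    gcongr
  have h4 : 0 ≤ ∑ i ∈ F, t i ^ 2 := Finset.sum_nonneg fun _ _ => sq_nonneg _
  calc ‖∑ i ∈ F, t i • e i‖ ^ 2 ≤ (2 * K * ‖g‖) ^ 2 := by gcongr
    _ = (2 * K) ^ 2 * ‖g‖ ^ 2 := by ring
    _ ≤ (2 * K) ^ 2 * (D ^ 2 * ∑ i ∈ F, t i ^ 2) := by gcongr
    _ ≤ _ := by nlinarith

end Riesz

/-! ### Wavelets in L² and the reconstruction error. -/

theorem eLpNorm_comp_mul_sub {g : ℝ → ℝ} (hg : AEStronglyMeasurable g volume) {a : ℝ} (ha : 0 < a)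
    (k : ℝ) : AEStronglyMeasurable (fun x => g (a * x - k)) volume ∧
    eLpNorm (fun x => g (a * x - k)) 2 volume =
      ENNReal.ofReal a⁻¹ ^ (1 / 2 : ℝ) * eLpNorm g 2 volume := by
  have hmp := measurePreserving_sub_right (volume : Measure ℝ) k
  have hg' : AEStronglyMeasurable (fun x => g (x - k)) volume :=
    hg.comp_measurePreserving hmp
  have h1 : eLpNorm (fun x => g (x - k)) 2 volume = eLpNorm g 2 volume :=
    eLpNorm_comp_measurePreserving hg hmp
  have hmap : volume.map (fun x => a * x) = ENNReal.ofReal a⁻¹ • (volume : Measure ℝ) := by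
    rw [Real.map_volume_mul_left ha.ne', abs_of_pos (inv_pos.2 ha)]
  have hg'' : AEStronglyMeasurable (fun x => g (x - k)) (volume.map (fun x => a * x)) := by
    rw [hmap]; exact hg'.smul_measure _
  have hm : AEMeasurable (fun x : ℝ => a * x) volume := (measurable_const_mul a).aemeasurable
  refine ⟨hg''.comp_aemeasurable hm, ?_⟩
  have h2 := eLpNorm_map_measure (p := 2) hg'' hm
  rw [hmap, eLpNorm_smul_measure_of_ne_top (by simp), h1, smul_eq_mul] at h2
  rw [show (fun x => g (a * x - k)) = (fun x => g (x - k)) ∘ fun x => a * x from rfl, ← h2]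
  norm_num

theorem memLp_atom {φ ψ : ℝ → ℝ} (hφ : MemLp φ 2 volume) (hψ : MemLp ψ 2 volume) (l : Index) :
    MemLp (atom φ ψ l) 2 volume ∧
      eLpNorm (atom φ ψ l) 2 volume ≤ max (eLpNorm φ 2 volume) (eLpNorm ψ 2 volume) := by
  have hfin : max (eLpNorm φ 2 volume) (eLpNorm ψ 2 volume) < ⊤ := max_lt hφ.2 hψ.2
  suffices h : AEStronglyMeasurable (atom φ ψ l) volume ∧
      eLpNorm (atom φ ψ l) 2 volume ≤ max (eLpNorm φ 2 volume) (eLpNorm ψ 2 volume) from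
    ⟨⟨h.1, h.2.trans_lt hfin⟩, h.2⟩
  by_cases hl : l.1.1 = -1
  · have he : atom φ ψ l = fun x => φ (1 * x - l.1.2) := by ext x; simp [atom, hl]
    obtain ⟨h1, h2⟩ := eLpNorm_comp_mul_sub hφ.1 one_pos (l.1.2 : ℝ)
    rw [he, h2]
    exact ⟨h1, by simp⟩
  · have he : atom φ ψ l = (2 : ℝ) ^ ((l.1.1 : ℝ) / 2) •
        fun x => ψ ((2 : ℝ) ^ l.1.1 * x - l.1.2) := by
      ext x; simp [atom, hl, dilate]
    have h2j : (0 : ℝ) < 2 ^ l.1.1 := by positivity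
    obtain ⟨h1, h2⟩ := eLpNorm_comp_mul_sub hψ.1 h2j (l.1.2 : ℝ)
    rw [he]
    refine ⟨h1.const_smul _, ?_⟩
    rw [eLpNorm_const_smul, h2, ← mul_assoc]
    have h3 : ‖(2 : ℝ) ^ ((l.1.1 : ℝ) / 2)‖ₑ * ENNReal.ofReal ((2 : ℝ) ^ l.1.1)⁻¹ ^ (1 / 2 : ℝ)
        = 1 := by
      rw [Real.enorm_of_nonneg (by positivity), ENNReal.ofReal_rpow_of_nonneg (by positivity)
        (by norm_num), ← ENNReal.ofReal_mul (by positivity), ← Real.rpow_intCast,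
        ← Real.rpow_neg (by norm_num), ← Real.rpow_mul (by norm_num),
        ← Real.rpow_add (by norm_num)]
      ring_nf
      simp
    rw [h3, one_mul]
    exact le_max_right _ _

theorem memLp_of_finite_range_of_hasCompactSupport {g : ℝ → ℝ} (hg : Measurable g)
    (hs : (Set.range g).Finite) (hc : HasCompactSupport g) : MemLp g 2 volume := by
  obtain ⟨C, hC⟩ := hs.isBounded.exists_norm_le
  have hK : MeasurableSet (tsupport g) := (isClosed_tsupport g).measurableSet
  have : IsFiniteMeasure (volume.restrict (tsupport g)) :=
    ⟨by rw [Measure.restrict_apply_univ]; exact hc.isCompact.measure_lt_top⟩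
  have h1 : MemLp g 2 (volume.restrict (tsupport g)) :=
    MemLp.of_bound hg.aestronglyMeasurable C (ae_of_all _ fun x => hC _ ⟨x, rfl⟩)
  rw [← memLp_indicator_iff_restrict hK] at h1
  rwa [Set.indicator_eq_self.2 (subset_tsupport g)] at h1

/-- The abstract Riesz inequality applies in `Lp`: the factor 2^{j/2} makes dilation an isometry, so
the synthesis atoms are bounded, and `decomposition` is unconditional convergence. -/
theorem exists_eLpNorm_sq_sum_le {r : ℝ} {ψ φ' ψ' : ℝ → ℝ}
    (hb : IsBiorthogonalWaveletBasis r ψ φ' ψ') (ha : ∀ l, MemLp (atom father ψ l) 2 volume) :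
    ∃ C : ℝ, 0 < C ∧ ∀ (F : Finset Index) (t : Index → ℝ),
      eLpNorm (fun x => ∑ l ∈ F, t l * atom φ' ψ' l x) 2 volume ^ 2 ≤
        ENNReal.ofReal (C * ∑ l ∈ F, t l ^ 2) := by
  have he := fun l => (memLp_atom hb.memLp_φ' hb.memLp_ψ' l).1
  let a : Index → Lp ℝ 2 (volume : Measure ℝ) := fun l => (ha l).toLp
  let e : Index → Lp ℝ 2 (volume : Measure ℝ) := fun l => (he l).toLp
  have hinner : ∀ l (G : Lp ℝ 2 (volume : Measure ℝ)), inner ℝ (a l) G = coeff ψ G l := by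
    intro l G
    rw [L2.inner_def]
    refine integral_congr_ae ?_
    filter_upwards [(ha l).coeFn_toLp] with x hx
    simp [a, hx, mul_comm]
  have hsum_ae : ∀ (F : Finset Index) (t : Index → ℝ),
      ((∑ l ∈ F, t l • e l : Lp ℝ 2 (volume : Measure ℝ)) : ℝ → ℝ) =ᵐ[volume]
        fun x => ∑ l ∈ F, t l * atom φ' ψ' l x := by
    intro F t
    have h2 : ∀ᵐ x, ∀ l ∈ F, ((t l • e l : Lp ℝ 2 (volume : Measure ℝ)) : ℝ → ℝ) x =
        t l * atom φ' ψ' l x := by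
      rw [Finset.eventually_all]
      intro l _
      filter_upwards [Lp.coeFn_smul (t l) (e l), (he l).coeFn_toLp] with x h3 h4
      rw [h3, Pi.smul_apply, h4, smul_eq_mul]
    filter_upwards [Lp.coeFn_finsetSum F (fun l => t l • e l), h2] with x h1 h2
    rw [h1, Finset.sum_apply]
    exact Finset.sum_congr rfl fun l hl => h2 l hl
  have hae : ∀ i j, inner ℝ (a i) (e j) = if i = j then 1 else 0 := by
    intro i j
    rw [hinner, ← hb.biorthogonal i j]
    refine integral_congr_ae ?_
    filter_upwards [(he j).coeFn_toLp] with x hx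
    simp only [e, hx]
  have hD : ∀ l, ‖e l‖ ≤ (max (eLpNorm φ' 2 volume) (eLpNorm ψ' 2 volume)).toReal := by
    intro l
    rw [Lp.norm_toLp]
    exact ENNReal.toReal_mono (max_lt hb.memLp_φ'.2 hb.memLp_ψ'.2).ne
      (memLp_atom hb.memLp_φ' hb.memLp_ψ' l).2
  have hsum : ∀ G, HasSum (fun l => inner ℝ (a l) G • e l) G := by
    intro G
    have h1 := hb.decomposition G (Lp.memLp G)
    rw [HasSum, SummationFilter.unconditional_filter, Lp.tendsto_Lp_iff_tendsto_eLpNorm']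
    refine h1.congr fun F => ?_
    rw [eLpNorm_sub_comm]
    refine eLpNorm_congr_ae ?_
    filter_upwards [hsum_ae F (fun l => inner ℝ (a l) G)] with x hx
    rw [Pi.sub_apply, hx]
    simp only [hinner]
  obtain ⟨C, hC0, hC⟩ := exists_norm_sq_sum_le_of_hasSum hae hD hsum
  refine ⟨C, hC0, fun F t => ?_⟩
  have h1 := hC F t
  rw [← eLpNorm_congr_ae (hsum_ae F t), ← Lp.enorm_def,
    ← ofReal_norm, ← ENNReal.ofReal_pow (norm_nonneg _)]
  exact ENNReal.ofReal_le_ofReal h1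

/-- The reconstruction error is controlled by the error on the coefficients. -/
theorem eLpNorm_sq_reconstruction_sub_le {r : ℝ} {ψ φ' ψ' : ℝ → ℝ}
    (hb : IsBiorthogonalWaveletBasis r ψ φ' ψ') {C : ℝ} (hC0 : 0 ≤ C)
    (hC : ∀ (F : Finset Index) (t : Index → ℝ),
      eLpNorm (fun x => ∑ l ∈ F, t l * atom φ' ψ' l x) 2 volume ^ 2 ≤
        ENNReal.ofReal (C * ∑ l ∈ F, t l ^ 2))
    {f : ℝ → ℝ} (hf : MemLp f 2 volume) {t : Index → ℝ} (ht : (Function.support t).Finite) :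
    eLpNorm (fun x => (∑' l, t l * atom φ' ψ' l x) - f x) 2 volume ^ 2 ≤
      ENNReal.ofReal C * ∑' l, ENNReal.ofReal ((t l - coeff ψ f l) ^ 2) := by
  set β := coeff ψ f
  set T := ENNReal.ofReal C * ∑' l, ENNReal.ofReal ((t l - β l) ^ 2) with hT
  have hm : ∀ (F : Finset Index) (s : Index → ℝ),
      AEStronglyMeasurable (fun x => ∑ l ∈ F, s l * atom φ' ψ' l x) volume := by
    intro F s
    refine Finset.aestronglyMeasurable_fun_sum _ fun l _ => ?_
    exact (memLp_atom hb.memLp_φ' hb.memLp_ψ' l).1.1.const_mul _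
  have hlim : Tendsto (fun F : Finset Index => T ^ (1 / 2 : ℝ) +
      eLpNorm (fun x => f x - ∑ l ∈ F, β l * atom φ' ψ' l x) 2 volume) atTop
      (𝓝 (T ^ (1 / 2 : ℝ) + 0)) :=
    tendsto_const_nhds.add (hb.decomposition f hf)
  rw [add_zero] at hlim
  have hle : eLpNorm (fun x => (∑' l, t l * atom φ' ψ' l x) - f x) 2 volume ≤ T ^ (1 / 2 : ℝ) := by
    -- For F containing the support of t, the error is a finite combination with coefficients t - β
    -- minus the remainder of the expansion of f, which tends to 0.
    refine ge_of_tendsto hlim ?_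
    filter_upwards [eventually_ge_atTop ht.toFinset] with F hF
    have h1 : (fun x => (∑' l, t l * atom φ' ψ' l x) - f x) =
        (fun x => ∑ l ∈ F, (t l - β l) * atom φ' ψ' l x) -
          fun x => f x - ∑ l ∈ F, β l * atom φ' ψ' l x := by
      ext x
      rw [tsum_eq_sum (s := F)]
      · simp only [Pi.sub_apply, sub_mul, Finset.sum_sub_distrib]
        ring
      · intro l hl
        have : t l = 0 := by
          by_contra h
          exact hl (hF (by simpa using h))
        rw [this, zero_mul]
    rw [h1]
    refine (eLpNorm_sub_le (hm _ _) (hf.1.sub (hm _ _)) (by norm_num)).trans ?_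
    refine add_le_add ?_ le_rfl
    rw [one_div, ENNReal.le_rpow_inv_iff (by norm_num), ENNReal.rpow_ofNat, hT]
    refine (hC F fun l => t l - β l).trans ?_
    rw [ENNReal.ofReal_mul hC0, ENNReal.ofReal_sum_of_nonneg fun _ _ => sq_nonneg _]
    gcongr
    exact ENNReal.sum_le_tsum F
  calc _ ≤ (T ^ (1 / 2 : ℝ)) ^ 2 := by gcongr
    _ = T := by
      rw [← ENNReal.rpow_natCast, ← ENNReal.rpow_mul]; norm_num

/-! ### Analysis wavelets: finite range, sup norms and overlap of supports. -/

/-- g factors through σ, which records the position of x relative to each break point and takes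
values in a finite type. -/
theorem isPiecewiseConstant_measurable_finite_range {g : ℝ → ℝ} (hg : IsPiecewiseConstant g) :
    Measurable g ∧ (Set.range g).Finite := by
  classical
  obtain ⟨S, hS⟩ := hg
  let σ : ℝ → (S → Bool × Bool) := fun x s => (decide (x < s), decide (x = s))
  have hσ : Measurable σ := by
    refine measurable_pi_lambda _ fun s => Measurable.prodMk ?_ ?_
    · refine measurable_to_bool ?_
      have h : (fun x : ℝ => decide (x < s)) ⁻¹' {true} = Set.Iio (s : ℝ) := by ext x; simp
      rw [h]; exact measurableSet_Iio
    · refine measurable_to_bool ?_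
      have h : (fun x : ℝ => decide (x = s)) ⁻¹' {true} = {(s : ℝ)} := by ext x; simp
      rw [h]; exact measurableSet_singleton _
  have key : ∀ x y, x ≤ y → σ x = σ y → g x = g y := by
    intro x y hxy h
    rcases hxy.eq_or_lt with rfl | hlt
    · rfl
    refine hS x y hxy (Set.disjoint_left.2 fun s hs hsS => ?_)
    have h1 := congrFun h ⟨s, hsS⟩
    simp only [σ, Prod.mk.injEq, decide_eq_decide] at h1
    rcases hs.1.eq_or_lt with h2 | h2
    · have := h1.2.1 h2
      linarith
    · have := h1.1.1 h2
      linarith [hs.2]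
  have key' : ∀ x y, σ x = σ y → g x = g y := by
    intro x y h
    rcases le_total x y with hxy | hxy
    · exact key x y hxy h
    · exact (key y x hxy h.symm).symm
  have hfac : g = (Function.extend σ g 0) ∘ σ := by
    ext x
    have hft : g.FactorsThrough σ := fun a b hab => key' a b hab
    exact (hft.extend_apply 0 x).symm
  constructor
  · rw [hfac]
    exact Measurable.of_discrete.comp hσ
  · rw [hfac, Set.range_comp]
    exact Set.toFinite _

theorem exists_mul_iSup_abs_le {g : ℝ → ℝ} (hs : (Set.range g).Finite) (h0 : ∃ x, g x ≠ 0) :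
    0 < ⨆ x, |g x| ∧ (∀ x, |g x| ≤ ⨆ x, |g x|) ∧
      ∃ c₀ : ℝ, 0 < c₀ ∧ c₀ ≤ 1 ∧ ∀ x, g x ≠ 0 → c₀ * ⨆ x, |g x| ≤ |g x| := by
  have hfin : (Set.range fun x => |g x|).Finite := finite_range_comp hs abs
  have hle : ∀ x, |g x| ≤ ⨆ x, |g x| := fun x => le_ciSup hfin.bddAbove x
  obtain ⟨x₀, hx₀⟩ := h0
  have hpos : 0 < ⨆ x, |g x| := (abs_pos.2 hx₀).trans_le (hle x₀)
  have hne : ((Set.range fun x => |g x|) \ {0}).Nonempty := ⟨|g x₀|, ⟨x₀, rfl⟩, by simpa using hx₀⟩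
  obtain ⟨m, ⟨⟨x₁, hx₁⟩, hm0⟩, hm⟩ :=
    Set.exists_min_image _ id (hfin.subset Set.sdiff_subset) hne
  have hmpos : 0 < m := by
    rw [← hx₁]
    refine lt_of_le_of_ne (abs_nonneg _) fun h => hm0 ?_
    rw [← hx₁]; exact h.symm
  refine ⟨hpos, hle, m / ⨆ x, |g x|, by positivity, ?_, fun x hx => ?_⟩
  · rw [div_le_one hpos, ← hx₁]; exact hle x₁
  · rw [div_mul_cancel₀ _ hpos.ne']
    exact hm _ ⟨⟨x, rfl⟩, abs_ne_zero.2 hx⟩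

/-- The dilation factor of the atoms of level `j`. -/
noncomputable def scale (j : ℤ) : ℝ := if j = -1 then 1 else 2 ^ j

theorem scale_pos (j : ℤ) : 0 < scale j := by unfold scale; split_ifs <;> positivity

theorem atom_eq (φ ψ : ℝ → ℝ) (l : Index) (x : ℝ) :
    atom φ ψ l x = (if l.1.1 = -1 then 1 else (2 : ℝ) ^ ((l.1.1 : ℝ) / 2)) *
      (if l.1.1 = -1 then φ else ψ) (scale l.1.1 * x - l.1.2) := by
  unfold atom dilate scale
  split_ifs <;> simp

theorem surjective_scale_mul_sub (j : ℤ) (k : ℝ) :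
    Function.Surjective fun x : ℝ => scale j * x - k := fun z =>
  ⟨(z + k) / scale j, by have := (scale_pos j).ne'; field_simp; ring⟩

theorem measurable_atom {φ ψ : ℝ → ℝ} (hφ : Measurable φ) (hψ : Measurable ψ) (l : Index) :
    Measurable (atom φ ψ l) := by
  have h : Measurable (if l.1.1 = -1 then φ else ψ) := by split_ifs <;> assumption
  rw [funext (atom_eq φ ψ l)]
  exact (h.comp (by fun_prop)).const_mul _

theorem finite_range_atom {φ ψ : ℝ → ℝ} (hφ : (Set.range φ).Finite) (hψ : (Set.range ψ).Finite)
    (l : Index) : (Set.range (atom φ ψ l)).Finite := by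
  have h : (Set.range (if l.1.1 = -1 then φ else ψ)).Finite := by split_ifs <;> assumption
  rw [funext (atom_eq φ ψ l)]
  exact finite_range_comp (h.subset (Set.range_comp_subset_range
    (fun x : ℝ => scale l.1.1 * x - l.1.2) _)) (fun v => _ * v)

theorem measurable_father : Measurable father := measurable_one.indicator measurableSet_Icc

theorem finite_range_father : (Set.range father).Finite := finite_range_indicator _

theorem exists_supNorm_bounds {ψ : ℝ → ℝ} (hψ : (Set.range ψ).Finite) (h0 : ∃ x, ψ x ≠ 0) :
    ∃ c₀ : ℝ, 0 < c₀ ∧ c₀ ≤ 1 ∧ ∃ D : ℝ, 0 < D ∧ ∀ l, 0 < supNorm ψ l ∧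
      (∀ x, |atom father ψ l x| ≤ supNorm ψ l) ∧
      (∀ x, atom father ψ l x ≠ 0 → c₀ * supNorm ψ l ≤ |atom father ψ l x|) ∧
      supNorm ψ l ^ 2 ≤ D * 2 ^ l.1.1 := by
  obtain ⟨hp, hle, c, hc, hc1, hcle⟩ := exists_mul_iSup_abs_le hψ h0
  obtain ⟨hp', hle', c', hc', hc1', hcle'⟩ := exists_mul_iSup_abs_le finite_range_father
    ⟨0, by simp [father]⟩
  set s := ⨆ x, |ψ x|
  set s' := ⨆ x, |father x|
  -- The factor 2 compensates 2^j = 1/2 at level j = -1, where the atoms are not dilated.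
  refine ⟨min c c', lt_min hc hc', (min_le_left _ _).trans hc1, 2 * s' ^ 2 + s ^ 2,
    by positivity, fun l => ?_⟩
  have hsup : ∀ (g : ℝ → ℝ) (A : ℝ), 0 ≤ A →
      ⨆ x, |A * g (scale l.1.1 * x - l.1.2)| = A * ⨆ x, |g x| := by
    intro g A hA
    simp_rw [abs_mul, abs_of_nonneg hA]
    rw [← Real.mul_iSup_of_nonneg hA]
    congr 1
    exact (surjective_scale_mul_sub l.1.1 l.1.2).iSup_comp (g := fun z => |g z|)
  have hS : supNorm ψ l = (if l.1.1 = -1 then 1 else (2 : ℝ) ^ ((l.1.1 : ℝ) / 2)) *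
      if l.1.1 = -1 then s' else s := by
    unfold supNorm
    simp_rw [atom_eq]
    rw [hsup _ _ (by split_ifs <;> positivity)]
    split_ifs <;> rfl
  rw [hS]
  simp_rw [atom_eq]
  by_cases hl : l.1.1 = -1
  · simp only [hl, if_true, one_mul]
    refine ⟨hp', fun x => hle' _, fun x hx => ?_, ?_⟩
    · refine le_trans ?_ (hcle' _ hx)
      gcongr
      exact min_le_right _ _
    · rw [zpow_neg_one]
      nlinarith [sq_nonneg s]
  · simp only [hl, if_false]
    set A := (2 : ℝ) ^ ((l.1.1 : ℝ) / 2)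
    have hA : 0 < A := by positivity
    have hA2 : A ^ 2 = 2 ^ l.1.1 := by
      rw [← Real.rpow_natCast, ← Real.rpow_mul (by norm_num), ← Real.rpow_intCast]
      norm_num
    refine ⟨by positivity, fun x => ?_, fun x hx => ?_, ?_⟩
    · rw [abs_mul, abs_of_pos hA]
      gcongr
      exact hle _
    · rw [abs_mul, abs_of_pos hA]
      have h1 := hcle _ (right_ne_zero_of_mul hx)
      have h2 : min c c' * s ≤ c * s := by gcongr; exact min_le_left _ _
      calc min c c' * (A * s) = A * (min c c' * s) := by ring
        _ ≤ _ := by gcongr; exact h2.trans h1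
    · rw [mul_pow, hA2]
      have : (0 : ℝ) < 2 ^ l.1.1 := by positivity
      nlinarith [sq_nonneg s', mul_nonneg this.le (sq_nonneg s')]

theorem sum_Icc_two_zpow_le (j₀ : ℤ) : ∑ j ∈ Finset.Icc (-1) j₀, (2 : ℝ) ^ j ≤ 2 * 2 ^ j₀ := by
  rcases lt_or_ge j₀ (-1) with h | h
  · rw [Finset.Icc_eq_empty (by omega), Finset.sum_empty]; positivity
  · induction j₀, h using Int.leInduction with
    | base => norm_num
    | succ n hn ih =>
      have h1 : Finset.Icc (-1) (n + 1) = insert (n + 1) (Finset.Icc (-1) n) := by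
        ext j; simp only [Finset.mem_Icc, Finset.mem_insert]; omega
      rw [h1, Finset.sum_insert (by simp), zpow_add_one₀ (by norm_num)]
      linarith

theorem tsum_indicator_abs_sub_le (X : ℝ) (A : ℕ) :
    ∑' k : ℤ, (if |X - k| ≤ A then (1 : ℝ≥0∞) else 0) ≤ 2 * A + 1 := by
  rw [tsum_eq_sum (s := Finset.Icc ⌈X - A⌉ ⌊X + A⌋)]
  · refine (Finset.sum_le_sum (g := fun _ => (1 : ℝ≥0∞)) fun k _ => ?_).trans ?_
    · split_ifs <;> simp
    · rw [Finset.sum_const, Int.card_Icc, nsmul_eq_mul, mul_one]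
      have h1 : (⌊X + A⌋ + 1 - ⌈X - A⌉).toNat ≤ 2 * A + 1 := by
        have h2 : (⌊X + A⌋ : ℝ) ≤ X + A := Int.floor_le _
        have h3 : X - A ≤ (⌈X - A⌉ : ℝ) := Int.le_ceil _
        have h4 : ((⌊X + A⌋ - ⌈X - A⌉ : ℤ) : ℝ) ≤ ((2 * A : ℤ) : ℝ) := by push_cast; linarith
        have h5 : ⌊X + A⌋ - ⌈X - A⌉ ≤ 2 * A := by exact_mod_cast h4
        omega
      exact_mod_cast h1
  · intro k hk
    rw [if_neg]
    contrapose! hk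
    rw [abs_le] at hk
    rw [Finset.mem_Icc, Int.ceil_le, Int.le_floor]
    constructor <;> linarith

/-- The supports of the atoms of level at most `j₀`, weighted by their squared amplitudes, have
total mass of order `2 ^ j₀`. -/
theorem exists_tsum_measure_support_le {ψ : ℝ → ℝ} (hψm : Measurable ψ)
    (hψ : HasCompactSupport ψ) {D : ℝ} (hD : 0 < D) :
    ∃ C : ℝ, 0 < C ∧ ∀ (j₀ : ℤ) (μ : Measure ℝ),
      ∑' l : ↥(levels j₀), ENNReal.ofReal (D * 2 ^ l.1.1.1) * μ {x | atom father ψ l x ≠ 0} ≤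
        ENNReal.ofReal (C * 2 ^ j₀) * μ Set.univ := by
  obtain ⟨R, hR⟩ := hψ.isCompact.isBounded.exists_norm_le
  obtain ⟨A, hA⟩ := exists_nat_ge (max R 1)
  have hsupp : ∀ (l : Index) x, atom father ψ l x ≠ 0 → |scale l.1.1 * x - l.1.2| ≤ A := by
    intro l x hx
    rw [atom_eq] at hx
    have h1 := right_ne_zero_of_mul hx
    split_ifs at h1 with hl
    · have h2 : scale l.1.1 * x - l.1.2 ∈ Set.Icc (0 : ℝ) 1 := by
        by_contra h
        exact h1 (Set.indicator_of_notMem h _)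
      rw [abs_of_nonneg h2.1]
      exact h2.2.trans ((le_max_right _ _).trans hA)
    · exact (hR _ (subset_tsupport ψ h1)).trans ((le_max_left _ _).trans hA)
  refine ⟨2 * D * (2 * A + 1), by positivity, fun j₀ μ => ?_⟩
  have hm : ∀ l : Index, MeasurableSet {x | atom father ψ l x ≠ 0} := fun l =>
    measurable_atom measurable_father hψm l (measurableSet_singleton 0).compl
  have h1 : ∀ l : ↥(levels j₀),
      ENNReal.ofReal (D * 2 ^ l.1.1.1) * μ {x | atom father ψ l x ≠ 0} =
      ∫⁻ x, {x | atom father ψ l x ≠ 0}.indicator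
        (fun _ => ENNReal.ofReal (D * 2 ^ l.1.1.1)) x ∂μ := fun l =>
    (lintegral_indicator_const (hm l) _).symm
  simp_rw [h1]
  -- By Tonelli it suffices to bound the weighted overlap at each point x, which meets at most 2A +
  -- 1 supports per level.
  rw [← lintegral_tsum fun l : ↥(levels j₀) => (measurable_const.indicator (hm l.1)).aemeasurable]
  rw [← lintegral_const]
  refine lintegral_mono fun x => ?_
  let G : ℤ × ℤ → ℝ≥0∞ := fun p =>
    (if p.1 ∈ Finset.Icc (-1) j₀ then ENNReal.ofReal (D * 2 ^ p.1) else 0) *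
      if |scale p.1 * x - p.2| ≤ A then 1 else 0
  calc ∑' l : ↥(levels j₀), {x | atom father ψ l x ≠ 0}.indicator
        (fun _ => ENNReal.ofReal (D * 2 ^ l.1.1.1)) x
      ≤ ∑' l : ↥(levels j₀), G l.1.1 := by
        refine ENNReal.tsum_le_tsum fun l => ?_
        by_cases hx : atom father ψ l x = 0
        · simp [hx]
        · have h2 := hsupp l.1 x hx
          have h3 : l.1.1.1 ∈ Finset.Icc (-1) j₀ := Finset.mem_Icc.2 ⟨l.1.2, l.2⟩
          rw [Set.indicator_of_mem (by exact hx)]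
          simp only [G]
          rw [if_pos h3, if_pos h2, mul_one]
    _ ≤ ∑' p : ℤ × ℤ, G p :=
        ENNReal.tsum_comp_le_tsum_of_injective
          (f := fun l : ↥(levels j₀) => l.1.1)
          (fun a b h => Subtype.ext (Subtype.ext h)) G
    _ = ∑' j : ℤ, (if j ∈ Finset.Icc (-1) j₀ then ENNReal.ofReal (D * 2 ^ j) else 0) *
          ∑' k : ℤ, if |scale j * x - k| ≤ A then 1 else 0 := by
        rw [ENNReal.tsum_prod']
        refine tsum_congr fun j => ?_
        simp only [G]
        rw [ENNReal.tsum_mul_left]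
    _ ≤ ∑' j : ℤ, (if j ∈ Finset.Icc (-1) j₀ then ENNReal.ofReal (D * 2 ^ j) else 0) *
          (2 * A + 1) := by
        refine ENNReal.tsum_le_tsum fun j => ?_
        gcongr
        exact tsum_indicator_abs_sub_le _ _
    _ = (∑ j ∈ Finset.Icc (-1) j₀, ENNReal.ofReal (D * 2 ^ j)) * (2 * A + 1) := by
        rw [ENNReal.tsum_mul_right, tsum_eq_sum (s := Finset.Icc (-1) j₀)
          (fun j hj => if_neg hj)]
        congr 1
        exact Finset.sum_congr rfl fun j hj => if_pos hj
    _ = ENNReal.ofReal (D * ∑ j ∈ Finset.Icc (-1) j₀, (2 : ℝ) ^ j) *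
          ENNReal.ofReal (2 * A + 1) := by
        rw [← ENNReal.ofReal_sum_of_nonneg (fun j _ => by positivity), Finset.mul_sum]
        congr 1
        rw [ENNReal.ofReal_add (by positivity) zero_le_one, ENNReal.ofReal_mul (by positivity)]
        simp
    _ ≤ ENNReal.ofReal (D * (2 * 2 ^ j₀)) * ENNReal.ofReal (2 * A + 1) := by
        gcongr
        exact sum_Icc_two_zpow_le j₀
    _ = _ := by
        rw [← ENNReal.ofReal_mul (by positivity)]
        congr 1
        ring

/-! ### The mean measure and the normalisation of coefficients. -/

theorem isFiniteMeasure_meanMeasure {f : ℝ → ℝ} (hf1 : MemLp f 1 volume) (n : ℕ) :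
    IsFiniteMeasure (volume.withDensity (fun x => ENNReal.ofReal (n * f x))) :=
  isFiniteMeasure_withDensity_ofReal ((memLp_one_iff_integrable.1 hf1).const_mul _).2

theorem integral_meanMeasure {f : ℝ → ℝ} (hf0 : 0 ≤ᵐ[volume] f) (hf1 : MemLp f 1 volume) (n : ℕ)
    (g : ℝ → ℝ) :
    ∫ x, g x ∂(volume.withDensity (fun x => ENNReal.ofReal (n * f x))) =
      n * ∫ x, g x * f x := by
  have hm : AEMeasurable (fun x => ENNReal.ofReal (n * f x)) volume :=
    (hf1.1.aemeasurable.const_mul _).ennreal_ofReal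
  rw [integral_withDensity_eq_integral_toReal_smul₀ hm (ae_of_all _ fun x => ENNReal.ofReal_lt_top),
    ← integral_const_mul]
  refine integral_congr_ae ?_
  filter_upwards [hf0] with x hx
  have hx' : 0 ≤ f x := hx
  rw [ENNReal.toReal_ofReal (by positivity), smul_eq_mul]
  ring

theorem meanMeasure_univ {f : ℝ → ℝ} (hf0 : 0 ≤ᵐ[volume] f) (hf1 : MemLp f 1 volume) (n : ℕ) :
    volume.withDensity (fun x => ENNReal.ofReal (n * f x)) Set.univ =
      ENNReal.ofReal (n * ∫ x, |f x|) := by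
  have hi := (memLp_one_iff_integrable.1 hf1).const_mul (n : ℝ)
  rw [withDensity_apply _ MeasurableSet.univ, Measure.restrict_univ,
    ← ofReal_integral_eq_lintegral_ofReal hi, integral_const_mul]
  · congr 2
    refine integral_congr_ae ?_
    filter_upwards [hf0] with x hx
    exact (abs_of_nonneg hx).symm
  · filter_upwards [hf0] with x hx
    have hx' : 0 ≤ f x := hx
    simp only [Pi.zero_apply]
    positivity

section Normalisation

variable {Ω : Type*} {N : Ω → Set ℝ} {ψ : ℝ → ℝ} {γ : ℝ} {n : ℕ} {l : Index}

theorem coeffHat_eq (hM : 0 < supNorm ψ l) (ω : Ω) :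
    coeffHat ψ n N l ω = supNorm ψ l / n *
      stochInt N (fun x => (supNorm ψ l)⁻¹ * atom father ψ l x) ω := by
  rw [stochInt_const_mul, coeffHat]
  field_simp

theorem VHat_eq (hM : 0 < supNorm ψ l) (ω : Ω) :
    VHat ψ n N l ω = (supNorm ψ l / n) ^ 2 *
      stochInt N (fun x => ((supNorm ψ l)⁻¹ * atom father ψ l x) ^ 2) ω := by
  simp_rw [mul_pow]
  rw [stochInt_const_mul, VHat]
  field_simp

/-- The threshold is homogeneous: `VTilde` scales as (‖φ_λ‖_∞ / n)², so both summands scale as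
‖φ_λ‖_∞ / n, like β̂_λ. -/
theorem threshold_eq (hM : 0 < supNorm ψ l) (ω : Ω) :
    threshold ψ γ n N l ω = supNorm ψ l / n * normThreshold (γ * Real.log n)
      (stochInt N (fun x => ((supNorm ψ l)⁻¹ * atom father ψ l x) ^ 2) ω) := by
  set W := stochInt N (fun x => ((supNorm ψ l)⁻¹ * atom father ψ l x) ^ 2) ω
  set s := supNorm ψ l / n with hs
  have hs0 : 0 ≤ s := by positivity
  have h1 : supNorm ψ l ^ 2 / (n : ℝ) ^ 2 = s ^ 2 := by rw [hs, div_pow]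
  have h2 : VTilde ψ γ n N l ω = s ^ 2 *
      (W + √(2 * (γ * Real.log n) * W) + 3 * (γ * Real.log n)) := by
    rw [VTilde, VHat_eq hM, ← hs, h1]
    have h3 : 2 * γ * Real.log n * (s ^ 2 * W) * s ^ 2 =
        (s ^ 2) ^ 2 * (2 * (γ * Real.log n) * W) := by ring
    rw [h3, Real.sqrt_mul (sq_nonneg _), Real.sqrt_sq (sq_nonneg s)]
    ring
  rw [threshold, h2, normThreshold]
  have h4 : 2 * γ * (s ^ 2 * (W + √(2 * (γ * Real.log n) * W) + 3 * (γ * Real.log n))) *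
      Real.log n = s ^ 2 * (2 * (γ * Real.log n) *
        (W + √(2 * (γ * Real.log n) * W) + 3 * (γ * Real.log n))) := by ring
  rw [h4, Real.sqrt_mul (sq_nonneg _), Real.sqrt_sq hs0, hs]
  ring

theorem coeffTilde_eq (hM : 0 < supNorm ψ l) (hn : 0 < n) {j₀ : ℤ} (hl : l ∈ levels j₀) (ω : Ω) :
    coeffTilde ψ γ n j₀ N l ω = supNorm ψ l / n *
      if normThreshold (γ * Real.log n)
          (stochInt N (fun x => ((supNorm ψ l)⁻¹ * atom father ψ l x) ^ 2) ω) ≤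
        |stochInt N (fun x => (supNorm ψ l)⁻¹ * atom father ψ l x) ω| then
      stochInt N (fun x => (supNorm ψ l)⁻¹ * atom father ψ l x) ω else 0 := by
  have hs0 : 0 < supNorm ψ l / n := by positivity
  rw [coeffTilde, threshold_eq hM, coeffHat_eq hM, abs_mul, abs_of_pos hs0]
  simp only [hl, and_true, mul_le_mul_iff_right₀ hs0]
  split_ifs <;> simp

end Normalisation

/-! ### Thresholded coefficients: measurability, finite support and risk. -/

section Risk

variable {Ω : Type*} [MeasurableSpace Ω] {P : Measure Ω}
  {N : Ω → Set ℝ} {μ : Measure ℝ} [IsFiniteMeasure μ] {ψ : ℝ → ℝ}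

theorem aemeasurable_coeffTilde (h : IsPoissonProcess P N μ) (hψm : Measurable ψ)
    (hψ : (Set.range ψ).Finite) (γ : ℝ) (n : ℕ) (j₀ : ℤ) (l : Index) :
    AEMeasurable (coeffTilde ψ γ n j₀ N l) P := by
  classical
  have hm := measurable_atom measurable_father hψm l
  have hf := finite_range_atom finite_range_father hψ l
  have h1 := aemeasurable_stochInt h hm hf
  have h2 := aemeasurable_stochInt h (hm.pow_const 2) (finite_range_comp hf (fun v => v ^ 2))
  have hB : AEMeasurable (coeffHat ψ n N l) P := h1.const_mul _
  have hV : AEMeasurable (VHat ψ n N l) P := h2.const_mul _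
  have hVt : AEMeasurable (VTilde ψ γ n N l) P := by
    unfold VTilde
    exact (hV.add ((hV.const_mul _).mul_const _).sqrt).add_const _
  have hT : AEMeasurable (threshold ψ γ n N l) P := by
    unfold threshold
    exact ((hVt.const_mul _).mul_const _).sqrt.add_const _
  by_cases hl : l ∈ levels j₀
  · have h3 : Measurable fun p : ℝ × ℝ => if p.1 ≤ |p.2| then p.2 else 0 :=
      Measurable.ite (measurableSet_le measurable_fst measurable_snd.abs) measurable_snd
        measurable_const
    have h4 := h3.comp_aemeasurable (hT.prodMk hB)
    refine h4.congr (ae_of_all _ fun ω => ?_)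
    simp only [Function.comp, coeffTilde, hl, and_true]
  · have : coeffTilde ψ γ n j₀ N l = fun _ => 0 := by
      ext ω; simp [coeffTilde, hl]
    rw [this]
    exact aemeasurable_const

end Risk

/-- A nonzero coefficient needs a point of N where its atom is nonzero, and each of the finitely
many points serves finitely many atoms on the levels from -1 to j₀. -/
theorem finite_support_coeffTilde {Ω : Type*} {N : Ω → Set ℝ} {ψ : ℝ → ℝ} (hψ : HasCompactSupport ψ) (γ : ℝ) (n : ℕ) (j₀ : ℤ) {ω : Ω}
    (hω : (N ω).Finite) : (Function.support fun l => coeffTilde ψ γ n j₀ N l ω).Finite := by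
  obtain ⟨R, hR⟩ := hψ.isCompact.isBounded.exists_norm_le
  set A := max R 1
  have hfin : (⋃ T ∈ N ω, ⋃ j ∈ Set.Icc (-1) j₀,
      (fun k : ℤ => (j, k)) '' Set.Icc ⌈scale j * T - A⌉ ⌊scale j * T + A⌋).Finite :=
    hω.biUnion fun T _ => (Set.finite_Icc _ _).biUnion fun j _ => (Set.finite_Icc _ _).image _
  refine (hfin.preimage (Subtype.val_injective (p := fun p : ℤ × ℤ => -1 ≤ p.1)).injOn).subset
    fun l hl => ?_
  have hl' : coeffTilde ψ γ n j₀ N l ω ≠ 0 := hl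
  unfold coeffTilde at hl'
  split_ifs at hl' with hcond
  · obtain ⟨T, hT⟩ : ∃ T : N ω, atom father ψ l T ≠ 0 := by
      by_contra! hcon
      apply hl'
      simp [coeffHat, stochInt, hcon]
    simp only [Set.mem_preimage, Set.mem_iUnion, Set.mem_image, exists_prop]
    refine ⟨T, T.2, l.1.1, ⟨l.2, hcond.2⟩, l.1.2, ?_, rfl⟩
    have h1 : |scale l.1.1 * T - l.1.2| ≤ A := by
      rw [atom_eq] at hT
      have h1 := right_ne_zero_of_mul hT
      split_ifs at h1 with hj
      · have h2 : scale l.1.1 * T - l.1.2 ∈ Set.Icc (0 : ℝ) 1 := by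
          by_contra h
          exact h1 (Set.indicator_of_notMem h _)
        rw [abs_of_nonneg h2.1]
        exact h2.2.trans (le_max_right _ _)
      · exact (hR _ (subset_tsupport ψ h1)).trans (le_max_left _ _)
    rw [abs_le] at h1
    rw [Set.mem_Icc, Int.ceil_le, Int.le_floor]
    constructor <;> linarith
  · exact absurd rfl hl'

/-- The risk of the thresholded estimator of the coefficient `β_λ`. -/
theorem exists_lintegral_coeffTilde_sub_sq_le {ψ : ℝ → ℝ} (hψm : Measurable ψ)
    (hψ : (Set.range ψ).Finite) {c₀ : ℝ} (hc₀ : 0 < c₀) (hc₀1 : c₀ ≤ 1)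
    (hM : ∀ l, 0 < supNorm ψ l) (hle : ∀ l x, |atom father ψ l x| ≤ supNorm ψ l)
    (hge : ∀ l x, atom father ψ l x ≠ 0 → c₀ * supNorm ψ l ≤ |atom father ψ l x|)
    {c γ : ℝ} (hc : 1 ≤ c) (hγ : c < γ) :
    ∃ C : ℝ, 0 < C ∧ ∃ l₀ : ℝ, 0 < l₀ ∧ ∀ n : ℕ, 0 < n → l₀ ≤ Real.log n →
      ∀ {f : ℝ → ℝ}, 0 ≤ᵐ[volume] f → MemLp f 1 volume →
      ∀ {Ω : Type*} [MeasurableSpace Ω] {P : Measure Ω} [IsProbabilityMeasure P]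
        {N : Ω → Set ℝ},
        IsPoissonProcess P N (volume.withDensity (fun x => ENNReal.ofReal (n * f x))) →
      ∀ {j₀ : ℤ}, ∀ l ∈ levels j₀,
      ∫⁻ ω, ENNReal.ofReal ((coeffTilde ψ γ n j₀ N l ω - coeff ψ f l) ^ 2) ∂P ≤
        ENNReal.ofReal C * ENNReal.ofReal (min (coeff ψ f l ^ 2) (V ψ f n l * Real.log n)) +
        ENNReal.ofReal (C / (n : ℝ) ^ 2 * Real.exp (-(c + (γ - c) / 4) * Real.log n)) *
          (ENNReal.ofReal (supNorm ψ l ^ 2) *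
            volume.withDensity (fun x => ENNReal.ofReal (n * f x))
              {x | atom father ψ l x ≠ 0}) := by
  obtain ⟨C, hC, l₀, hl₀, H⟩ := exists_coefficient_risk_bound hc hγ hc₀ hc₀1
  refine ⟨C, hC, l₀, hl₀, ?_⟩
  intro n hn hln f hf0 hf1 Ω _ P _ N hN j₀ l hl
  have hfin := isFiniteMeasure_meanMeasure hf1 n
  set μ := volume.withDensity (fun x => ENNReal.ofReal (n * f x)) with hμ
  have hMl := hM l
  set M := supNorm ψ l with hMdef
  have hn' : (0 : ℝ) < n := by exact_mod_cast hn
  set y : ℝ → ℝ := fun x => M⁻¹ * atom father ψ l x with hy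
  have hym : Measurable y := (measurable_atom measurable_father hψm l).const_mul _
  have hyf : (Set.range y).Finite :=
    finite_range_comp (finite_range_atom finite_range_father hψ l) (fun v => M⁻¹ * v)
  have hyabs : ∀ x, |y x| = |atom father ψ l x| / M := fun x => by
    rw [hy, abs_mul, abs_of_pos (inv_pos.2 hMl), div_eq_inv_mul]
  have hy1 : ∀ x, |y x| ≤ 1 := fun x => by
    rw [hyabs, div_le_one hMl]; exact hle l x
  have hsupp : ∀ x, y x ≠ 0 ↔ atom father ψ l x ≠ 0 := fun x => by
    simp [hy, hMl.ne']
  have hyc : ∀ x, y x ≠ 0 → c₀ ≤ |y x| := fun x hx => by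
    rw [hyabs, le_div_iff₀ hMl]; exact hge l x ((hsupp x).1 hx)
  have key := H (Real.log n) hln hN hym hyf hy1 hyc
  have hset : {x | y x ≠ 0} = {x | atom father ψ l x ≠ 0} := Set.ext hsupp
  rw [hset] at key
  set p := μ.real {x | atom father ψ l x ≠ 0} with hp
  set b := ∫ x, y x ∂μ with hbdef
  set v := ∫ x, y x ^ 2 ∂μ with hvdef
  have hb : coeff ψ f l = M / n * b := by
    rw [hbdef, integral_meanMeasure hf0 hf1, coeff]
    simp_rw [hy, mul_assoc]
    rw [integral_const_mul]
    field_simp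
  have hv : V ψ f n l = (M / n) ^ 2 * v := by
    rw [hvdef, integral_meanMeasure hf0 hf1, V]
    simp_rw [hy, mul_pow, mul_assoc]
    rw [integral_const_mul]
    field_simp
  set s := M / n with hs
  have hs0 : 0 < s := by positivity
  have hlog : 0 ≤ Real.log n := hl₀.le.trans hln
  have hv0 : 0 ≤ v := integral_nonneg fun x => sq_nonneg _
  set e := Real.exp (-(c + (γ - c) / 4) * Real.log n)
  have he : 0 < e := Real.exp_pos _
  have hp0 : 0 ≤ p := measureReal_nonneg
  have hmin : min (coeff ψ f l ^ 2) (V ψ f n l * Real.log n) =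
      s ^ 2 * min (b ^ 2) (v * Real.log n) := by
    rw [hb, hv, mul_pow, mul_assoc, mul_min_of_nonneg _ _ (sq_nonneg s)]
  calc ∫⁻ ω, ENNReal.ofReal ((coeffTilde ψ γ n j₀ N l ω - coeff ψ f l) ^ 2) ∂P
      = ENNReal.ofReal (s ^ 2) * ∫⁻ ω, ENNReal.ofReal
        (((if normThreshold (γ * Real.log n) (stochInt N (fun x => y x ^ 2) ω)
        ≤ |stochInt N y ω| then stochInt N y ω else 0) - b) ^ 2) ∂P := by
        rw [← lintegral_const_mul' _ _ ENNReal.ofReal_ne_top]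
        refine lintegral_congr fun ω => ?_
        rw [← ENNReal.ofReal_mul (sq_nonneg s), coeffTilde_eq hMl hn hl, hb, ← mul_sub, mul_pow]
    _ ≤ ENNReal.ofReal (s ^ 2) *
        ENNReal.ofReal (C * (min (b ^ 2) (v * Real.log n) + p * e)) := by gcongr
    _ = ENNReal.ofReal (C * (s ^ 2 * min (b ^ 2) (v * Real.log n)) +
          C / (n : ℝ) ^ 2 * e * (M ^ 2 * p)) := by
        rw [← ENNReal.ofReal_mul (sq_nonneg s)]
        congr 1
        rw [hs]
        field_simp
    _ = _ := by
        have h0 : 0 ≤ min (b ^ 2) (v * Real.log n) := le_min (sq_nonneg _) (by positivity)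
        rw [hmin, ← ofReal_measureReal, ← ENNReal.ofReal_mul (sq_nonneg M),
          ← ENNReal.ofReal_mul hC.le, ← ENNReal.ofReal_mul (by positivity),
          ← ENNReal.ofReal_add (by positivity) (by positivity)]

/-! ### Summation over the coefficients. -/

theorem exists_log_rpow_le_rpow {c' d : ℝ} (hd : 0 < d) (l₀ : ℝ) :
    ∃ n₀ : ℕ, 2 ≤ n₀ ∧ ∀ n : ℕ, n₀ ≤ n →
      Real.log n ^ c' ≤ (n : ℝ) ^ d ∧ l₀ ≤ Real.log n := by
  have h1 : ∀ᶠ x : ℝ in atTop, Real.log x ^ c' ≤ x ^ d := by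
    filter_upwards [(isLittleO_log_rpow_rpow_atTop c' hd).bound one_pos, eventually_ge_atTop 0]
      with x hx hx0
    rw [one_mul, Real.norm_of_nonneg (Real.rpow_nonneg hx0 d)] at hx
    exact (le_abs_self _).trans hx
  have h2 : ∀ᶠ x : ℝ in atTop, l₀ ≤ Real.log x :=
    Real.tendsto_log_atTop.eventually_ge_atTop l₀
  obtain ⟨n₀, hn₀⟩ :=
    eventually_atTop.1 (tendsto_natCast_atTop_atTop.eventually (h1.and h2))
  exact ⟨max n₀ 2, le_max_right _ _, fun n hn => hn₀ n ((le_max_left _ _).trans hn)⟩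

theorem theorem1
    (ψ φ' ψ' : ℝ → ℝ) (hbasis : ∃ r : ℝ, IsBiorthogonalWaveletBasis r ψ φ' ψ')
    (c γ : ℝ) (hc : 1 ≤ c) (hγ : c < γ) :
    ∃ C₁ : ℝ, 0 < C₁ ∧ ∀ (c' L : ℝ),
      ∃ C₂ : ℝ, 0 < C₂ ∧ ∃ n₀ : ℕ, 2 ≤ n₀ ∧
        ∀ f : ℝ → ℝ, 0 ≤ᵐ[volume] f → MemLp f 1 volume → MemLp f 2 volume → ∫ x, |f x| = L →
        ∀ n : ℕ, n₀ ≤ n →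
        ∀ j₀ : ℤ, (2 : ℝ) ^ j₀ ≤ (n : ℝ) ^ c * Real.log n ^ c' →
          (n : ℝ) ^ c * Real.log n ^ c' < (2 : ℝ) ^ (j₀ + 1) →
        ∀ (Ω : Type*) [MeasurableSpace Ω] (P : Measure Ω) [IsProbabilityMeasure P]
          (N : Ω → Set ℝ),
          IsPoissonProcess P N (volume.withDensity (fun x => ENNReal.ofReal (n * f x))) →
          risk P ψ φ' ψ' f γ n j₀ N ≤
            ENNReal.ofReal C₁ *
                ((∑' l : ↥(levels j₀),
                    ENNReal.ofReal (min (coeff ψ f l ^ 2) (V ψ f n l * Real.log n)))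
                  + ∑' l : ↥((levels j₀)ᶜ), ENNReal.ofReal (coeff ψ f l ^ 2))
              + ENNReal.ofReal (C₂ / n) := by
  obtain ⟨r, hb⟩ := hbasis
  obtain ⟨hψm, hψ⟩ := isPiecewiseConstant_measurable_finite_range hb.piecewise_ψ
  have hψ0 : ∃ x, ψ x ≠ 0 := by
    by_contra! hcon
    have h1 := hb.biorthogonal ⟨(0, 0), by norm_num⟩ ⟨(0, 0), by norm_num⟩
    simp [atom, dilate, hcon] at h1
  obtain ⟨c₀, hc₀, hc₀1, D, hD, hsup⟩ := exists_supNorm_bounds hψ hψ0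
  obtain ⟨C, hC, l₀, hl₀, hcoef⟩ := exists_lintegral_coeffTilde_sub_sq_le hψm hψ hc₀ hc₀1
    (fun l => (hsup l).1) (fun l => (hsup l).2.1) (fun l => (hsup l).2.2.1) hc hγ
  have hLp := fun l => (memLp_atom
    (memLp_of_finite_range_of_hasCompactSupport measurable_father finite_range_father
      (HasCompactSupport.intro isCompact_Icc fun x hx => Set.indicator_of_notMem hx _))
    (memLp_of_finite_range_of_hasCompactSupport hψm hψ hb.compact_ψ) l).1
  obtain ⟨R, hR, hRiesz⟩ := exists_eLpNorm_sq_sum_le hb hLp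
  obtain ⟨K, hK, hcount⟩ := exists_tsum_measure_support_le hψm hb.compact_ψ hD
  -- Fixed before c' and L. The summand 1 also covers the terms outside Γ_n, whose factor is R
  -- alone.
  refine ⟨R * (C + 1), by positivity, fun c' L => ?_⟩
  obtain ⟨n₀, hn₀, hlarge⟩ := exists_log_rpow_le_rpow (c' := c') (d := (γ - c) / 4)
    (by linarith) l₀
  refine ⟨R * C * K * |L| + 1, by positivity, n₀, hn₀, ?_⟩
  intro f hf0 hf1 hf2 hL n hn j₀ hj₀ _ Ω _ P _ N hN
  obtain ⟨hlog, hln⟩ := hlarge n hn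
  have hn0 : 0 < n := by omega
  have hn' : (0 : ℝ) < n := by exact_mod_cast hn0
  have hfin := isFiniteMeasure_meanMeasure hf1 n
  have huniv := meanMeasure_univ hf0 hf1 n
  set μ := volume.withDensity (fun x => ENNReal.ofReal (n * f x)) with hμ
  set e := Real.exp (-(c + (γ - c) / 4) * Real.log n) with he
  have hL0 : 0 ≤ L := hL ▸ integral_nonneg fun x => abs_nonneg _
  -- The remaining quarter d of the gap absorbs (log n)^{c'}, whatever c' is.
  have hej : 2 ^ j₀ * e ≤ 1 := by
    have h1 : e = (n : ℝ) ^ (-(c + (γ - c) / 4)) := by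
      rw [he, Real.rpow_def_of_pos hn', mul_comm]
    calc 2 ^ j₀ * e ≤ ((n : ℝ) ^ c * (n : ℝ) ^ ((γ - c) / 4)) * e := by
          refine mul_le_mul_of_nonneg_right (hj₀.trans ?_) (Real.exp_pos _).le
          gcongr
      _ = 1 := by
          rw [h1, ← Real.rpow_add hn', ← Real.rpow_add hn', add_neg_cancel, Real.rpow_zero]
  set S₁ := ∑' l : ↥(levels j₀),
    ENNReal.ofReal (min (coeff ψ f l ^ 2) (V ψ f n l * Real.log n)) with hS₁
  set S₂ := ∑' l : ↥((levels j₀)ᶜ), ENNReal.ofReal (coeff ψ f l ^ 2) with hS₂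
  set E : Index → ℝ≥0∞ := fun l =>
    ∫⁻ ω, ENNReal.ofReal ((coeffTilde ψ γ n j₀ N l ω - coeff ψ f l) ^ 2) ∂P with hE
  have hrisk : risk P ψ φ' ψ' f γ n j₀ N ≤ ENNReal.ofReal R * ∑' l, E l := by
    calc risk P ψ φ' ψ' f γ n j₀ N
        ≤ ∫⁻ ω, ENNReal.ofReal R * ∑' l : Index,
          ENNReal.ofReal ((coeffTilde ψ γ n j₀ N l ω - coeff ψ f l) ^ 2) ∂P := by
          refine lintegral_mono_ae ?_
          filter_upwards [ae_finite_of_isPoissonProcess hN] with ω hω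
          exact eLpNorm_sq_reconstruction_sub_le hb hR.le hRiesz hf2
            (finite_support_coeffTilde hb.compact_ψ γ n j₀ hω)
      _ = _ := by
          rw [lintegral_const_mul' _ _ ENNReal.ofReal_ne_top, lintegral_tsum]
          exact fun l => (((aemeasurable_coeffTilde hN hψm hψ γ n j₀ l).sub_const _).pow_const
            2).ennreal_ofReal
  have hlow : ∑' l : ↥(levels j₀), E l ≤ ENNReal.ofReal C * S₁ + ENNReal.ofReal (C * K * L / n) := by
    calc ∑' l : ↥(levels j₀), E l
        ≤ ∑' l : ↥(levels j₀), (ENNReal.ofReal C *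
            ENNReal.ofReal (min (coeff ψ f l ^ 2) (V ψ f n l * Real.log n)) +
          ENNReal.ofReal (C / (n : ℝ) ^ 2 * e) *
            (ENNReal.ofReal (D * 2 ^ l.1.1.1) * μ {x | atom father ψ l x ≠ 0})) := by
          refine ENNReal.tsum_le_tsum fun l => (hcoef n hn0 hln hf0 hf1 hN l.1 l.2).trans ?_
          gcongr
          exact (hsup l.1).2.2.2
      _ ≤ ENNReal.ofReal C * S₁ + ENNReal.ofReal (C / (n : ℝ) ^ 2 * e) *
            (ENNReal.ofReal (K * 2 ^ j₀) * μ Set.univ) := by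
          rw [ENNReal.tsum_add, ENNReal.tsum_mul_left, ENNReal.tsum_mul_left]
          gcongr
          exact hcount j₀ μ
      _ ≤ _ := by
          gcongr
          rw [huniv, hL, ← ENNReal.ofReal_mul (by positivity), ← ENNReal.ofReal_mul (by positivity)]
          refine ENNReal.ofReal_le_ofReal ?_
          calc C / (n : ℝ) ^ 2 * e * (K * 2 ^ j₀ * (n * L))
              = C * K * L / n * (2 ^ j₀ * e) := by field_simp
            _ ≤ C * K * L / n * 1 := by gcongr
            _ = _ := mul_one _
  have hhigh : ∑' l : ↥((levels j₀)ᶜ), E l = S₂ := by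
    refine tsum_congr fun l => ?_
    have h1 : ∀ ω, coeffTilde ψ γ n j₀ N l.1 ω = 0 := fun ω => by
      have : l.1 ∉ levels j₀ := l.2
      simp [coeffTilde, this]
    simp [hE, h1]
  have hsplit : ∑' l, E l = ∑' l : ↥(levels j₀), E l + ∑' l : ↥((levels j₀)ᶜ), E l :=
    (ENNReal.summable.tsum_add_tsum_compl ENNReal.summable).symm
  calc risk P ψ φ' ψ' f γ n j₀ N
      ≤ ENNReal.ofReal R * (ENNReal.ofReal C * S₁ + ENNReal.ofReal (C * K * L / n) + S₂) := by
        refine hrisk.trans ?_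
        rw [hsplit, hhigh]
        gcongr
    _ = ENNReal.ofReal R * (ENNReal.ofReal C * S₁ + S₂) + ENNReal.ofReal (R * (C * K * L / n)) := by
        rw [ENNReal.ofReal_mul hR.le]
        ring
    _ ≤ ENNReal.ofReal R * (ENNReal.ofReal (C + 1) * S₁ + ENNReal.ofReal (C + 1) * S₂) +
          ENNReal.ofReal ((R * C * K * |L| + 1) / n) := by
        gcongr
        · linarith
        · exact le_mul_of_one_le_left' (by rw [ENNReal.one_le_ofReal]; linarith)
        · rw [← mul_div_assoc, abs_of_nonneg hL0]
          gcongr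
          linarith
    _ = _ := by
        rw [ENNReal.ofReal_mul hR.le]
        ring
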